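/- Let $k$ be a field and let $H$ be a finite group acting by automorphisms on a group $\Gamma$. Write $k^H$ for the algebra of functions $H\to k$, with idempotents $\delta_h$. The smash coproduct $k[\Gamma]\rtimes k^H$ is the Hopf algebra which is $k[\Gamma]\otimes k^H$ as an algebra (write $r\#f=r\otimes f$), with $$\Delta(r\#\delta_h)=\sum_{l\in H} r\#\delta_{l^{-1}}\otimes l.r\#\delta_{lh},\qquad \varepsilon(r\#\delta_h)=\delta_{h,1},\qquad S(r\#\delta_h)=h^{-1}.r^{-1}\#\delta_{h^{-1}}.$$ A quotient datum $(N,\Phi)$ consists of a normal $H$-stable subgroup $N$ of $\Gamma$ and a group morphism $\Phi:N\to(k^H)^\times$ with $\Phi(r)(lh)=\Phi(l^{-1}.r)(h)\,\Phi(r)(l)$ and $\Phi(r)=\Phi(srs^{-1})$ for all $r\in N$, $s\in\Gamma$, $h,l\in H$. Given such a datum, let $u:\Gamma\to\Gamma/N$ be the projection, let $j:\Gamma/N\to\Gamma$ be a section of $u$ with $j(1)=1$, and let $k[\Gamma/N]\rtimes_\Phi k^H$ be the Hopf algebra with underlying space $k[\Gamma/N]\otimes k^H$, unit $1\#1$,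 counit $\varepsilon(x\#\delta_h)=\delta_{h,1}$ and, for $x,y\in\Gamma/N$ and $g,h\in H$, $$(x\#\delta_h)(y\#\delta_g)=xy\#\delta_h\delta_g\,\Phi\big(j(x)j(y)j(xy)^{-1}\big),$$ $$\Delta(x\#\delta_h)=\sum_{l\in H}x\#\delta_{l^{-1}}\otimes l.x\#\delta_{lh}\,\Phi\big(l.j(x)\,j(l.x)^{-1}\big),$$ $$S(x\#\delta_h)=h^{-1}.x^{-1}\#\Phi\big(j(h^{-1}.x^{-1})^{-1}\,h^{-1}.j(x)^{-1}\big)\delta_{h^{-1}}.$$ For an algebra map $\rho:A\to R$ from a Hopf algebra $A$ to an algebra $R$, a factorization of $\rho$ is a triple $(L,q,\varphi)$ with $L$ a Hopf algebra, $q:A\to L$ a surjective Hopf algebra map and $\varphi:L\to R$ an algebra map such that $\rho=\varphi q$. The Hopf image of $\rho$ is the final factorization: a factorization $(A_\rho,p,\tilde\rho)$ such that for every factorization $(L,q,\varphi)$ there is a unique Hopf algebra map $f:L\to A_\rho$ with $fq=p$ and $\tilde\rho f=\varphi$. Let $R$ be a $k$-algebra and let $\rho:k[\Gamma]\rtimes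 k^H\to R$ be an algebra map whose restriction $f\mapsto\rho(1\#f)$ to $k^H$ is injective. Let $\mathcal E(\rho)$ be the set of quotient data $(N,\Phi)$ with $\rho(r\#1)=\rho(1\#\Phi(r))$ for all $r\in N$. Then: 1. The set $N_0=\{r\in\Gamma \mid \exists f\in k^H,\ \rho(r\#1)=\rho(1\#f)\}$ is a normal subgroup of $\Gamma$, and there is a unique group morphism $\Phi:N_0\to(k^H)^\times$ with $\rho(r\#1)=\rho(1\#\Phi(r))$ for all $r\in N_0$. 2. Put $$N=\{r\in N_0 \mid \forall g,h,l\in H,\ h.r\in N_0 \text{ and } \Phi(g.r)(lh)=\Phi\big((l^{-1}g).r\big)(h)\,\Phi(g.r)(l)\}.$$ Then $N$ is a normal and $H$-stable subgroup of $\Gamma$, and $(N,\Phi_{|N})\in\mathcal E(\rho)$. 3. The Hopf image of $\rho$ is isomorphic to $k[\Gamma/N]\rtimes_\Phi k^H$. More precisely, for every section $j$ as above there are a Hopf algebra map $q$ and an algebra map $\tilde\rho$ with $q(r\#f)=u(r)\#f\,\Phi\big(r\,j(u(r))^{-1}\big)$ and $\tilde\rho(x\#f)=\rho(j(x)\#f)$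 for $r\in\Gamma$, $x\in\Gamma/N$, $f\in k^H$, and $(k[\Gamma/N]\rtimes_\Phi k^H,\,q,\,\tilde\rho)$ is the Hopf image of $\rho$. -/

import Mathlib

open scoped TensorProduct

universe u v w x y


noncomputable section

/-! ## The vector space `k[Q] ⊗ k^H` -/

/-- The vector space `k[Q] ⊗ k^H`, where `k^H` is the algebra `H → k` of functions on `H`. -/
abbrev GroupTensorFun (k : Type u) (Q : Type v) (H : Type w) [Field k] : Type _ :=
  MonoidAlgebra k Q ⊗[k] (H → k)

/-- The basis `x ⊗ δ_h` of `k[Q] ⊗ k^H`. -/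
def GroupTensorFun.basis (k : Type u) (Q : Type v) (H : Type w) [Field k] [Fintype H] :
    Module.Basis (Q × H) k (GroupTensorFun k Q H) :=
  (MonoidAlgebra.basis Q k).tensorProduct (Pi.basisFun k H)

theorem GroupTensorFun.basis_apply (k : Type u) (Q : Type v) (H : Type w) [Field k] [Fintype H]
    [DecidableEq H] (p : Q × H) :
    GroupTensorFun.basis k Q H p = MonoidAlgebra.single p.1 (1 : k) ⊗ₜ[k] Pi.single p.2 (1 : k) := by
  simp [GroupTensorFun.basis, Module.Basis.tensorProduct_apply', MonoidAlgebra.basis]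

/-! ## The smash coproduct `k[Γ] ⋊ k^H` -/

/-- The smash coproduct `k[Γ] ⋊ k^H`; as an algebra it is the tensor product algebra
`k[Γ] ⊗ k^H`. It does not carry the tensor product coalgebra structure. -/
def SmashCoproduct (k : Type u) (Γ : Type v) (H : Type w) [Field k] : Type _ :=
  GroupTensorFun k Γ H

namespace SmashCoproduct

variable {k : Type u} {Γ : Type v} {H : Type w} [Field k] [Group Γ] [Group H]

instance : Ring (SmashCoproduct k Γ H) := inferInstanceAs (Ring (GroupTensorFun k Γ H))

instance : Algebra k (SmashCoproduct k Γ H) := inferInstanceAs (Algebra k (GroupTensorFun k Γ H))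

/-- The element `r # f = r ⊗ f` of `k[Γ] ⋊ k^H`, for `r ∈ Γ` and `f ∈ k^H`. -/
def elt (r : Γ) (f : H → k) : SmashCoproduct k Γ H :=
  (MonoidAlgebra.single r (1 : k) ⊗ₜ[k] f : GroupTensorFun k Γ H)

variable [Fintype H] [DecidableEq H]

/-- The basis `r # δ_h` of `k[Γ] ⋊ k^H`. -/
def basis : Module.Basis (Γ × H) k (SmashCoproduct k Γ H) := GroupTensorFun.basis k Γ H

/-- The basis element `r # δ_h`. -/
def e (r : Γ) (h : H) : SmashCoproduct k Γ H := elt r (Pi.single h 1)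

theorem basis_apply (r : Γ) (h : H) : (basis (r, h) : SmashCoproduct k Γ H) = e r h :=
  GroupTensorFun.basis_apply k Γ H (r, h)

theorem e_mul_e (r s : Γ) (h g : H) :
    (e r h * e s g : SmashCoproduct k Γ H) = if h = g then e (r * s) h else 0 := by
  change (MonoidAlgebra.single r (1 : k) ⊗ₜ[k] (Pi.single h 1) : GroupTensorFun k Γ H) *
    (MonoidAlgebra.single s (1 : k) ⊗ₜ[k] (Pi.single g 1) : GroupTensorFun k Γ H) = _
  rw [Algebra.TensorProduct.tmul_mul_tmul]
  split_ifs with hg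
  · subst hg
    rw [← Pi.single_mul, MonoidAlgebra.single_mul_single, one_mul]
    rfl
  · have : (Pi.single h 1 * Pi.single g 1 : H → k) = 0 := by
      ext a
      by_cases ha : a = h
      · subst ha
        simp [hg]
      · simp [ha]
    rw [this, TensorProduct.tmul_zero]
    rfl

theorem one_eq : (1 : SmashCoproduct k Γ H) = ∑ h : H, e 1 h := by
  change (1 ⊗ₜ[k] (1 : H → k) : GroupTensorFun k Γ H) =
    ∑ h : H, (MonoidAlgebra.single (1 : Γ) (1 : k) ⊗ₜ[k] (Pi.single h 1) : GroupTensorFun k Γ H)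
  rw [← TensorProduct.tmul_sum, Finset.univ_sum_single (1 : H → k) |>.symm]
  rfl

variable [MulDistribMulAction H Γ]

/-- `Δ(r # δ_h) = ∑_l (r # δ_{l⁻¹}) ⊗ (l.r # δ_{lh})`, `ε(r # δ_h) = δ_{h,1}`. -/
instance : CoalgebraStruct k (SmashCoproduct k Γ H) where
  comul := basis.constr k fun p => ∑ l : H, e p.1 l⁻¹ ⊗ₜ[k] e (l • p.1) (l * p.2)
  counit := basis.constr k fun p => if p.2 = 1 then 1 else 0

open Coalgebra

theorem comul_e (r : Γ) (h : H) : comul (R := k) (e r h : SmashCoproduct k Γ H) =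
    ∑ l : H, e r l⁻¹ ⊗ₜ[k] e (l • r) (l * h) := by
  rw [← basis_apply]
  exact basis.constr_basis k _ (r, h)

theorem counit_e (r : Γ) (h : H) :
    counit (R := k) (e r h : SmashCoproduct k Γ H) = if h = 1 then 1 else 0 := by
  rw [← basis_apply]
  exact basis.constr_basis k _ (r, h)

instance : Coalgebra k (SmashCoproduct k Γ H) where
  coassoc := by
    refine basis.ext fun p => ?_
    obtain ⟨r, h⟩ := p
    simp only [basis_apply, LinearMap.comp_apply, LinearEquiv.coe_coe, comul_e, map_sum,
      LinearMap.rTensor_tmul, LinearMap.lTensor_tmul, TensorProduct.sum_tmul,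
      TensorProduct.tmul_sum, TensorProduct.assoc_tmul]
    rw [Finset.sum_comm]
    refine Finset.sum_congr rfl fun m _ => ?_
    refine Fintype.sum_equiv (Equiv.mulRight m⁻¹) _ _ fun l => ?_
    simp [mul_smul, mul_assoc]
  rTensor_counit_comp_comul := by
    refine basis.ext fun p => ?_
    obtain ⟨r, h⟩ := p
    simp only [basis_apply, LinearMap.comp_apply, comul_e, map_sum, LinearMap.rTensor_tmul,
      counit_e, inv_eq_one]
    rw [Finset.sum_eq_single 1] <;> simp +contextual
  lTensor_counit_comp_comul := by
    refine basis.ext fun p => ?_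
    obtain ⟨r, h⟩ := p
    simp only [basis_apply, LinearMap.comp_apply, comul_e, map_sum, LinearMap.lTensor_tmul,
      counit_e, mul_eq_one_iff_eq_inv]
    rw [Finset.sum_eq_single h⁻¹] <;> simp +contextual

instance : Bialgebra k (SmashCoproduct k Γ H) where
  counit_one := by
    rw [one_eq, map_sum]
    simp [counit_e]
  mul_compr₂_counit := by
    refine basis.ext fun p => basis.ext fun p' => ?_
    obtain ⟨r, h⟩ := p
    obtain ⟨s, g⟩ := p'
    simp only [basis_apply, LinearMap.compr₂_apply, LinearMap.mul_apply', LinearMap.compl₁₂_apply,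
      e_mul_e, counit_e]
    split_ifs <;> simp_all [counit_e]
  comul_one := by
    rw [one_eq, map_sum, Algebra.TensorProduct.one_def, one_eq]
    simp only [comul_e, smul_one, TensorProduct.sum_tmul, TensorProduct.tmul_sum]
    rw [Finset.sum_comm]
    conv_rhs => rw [Finset.sum_comm]
    refine Fintype.sum_equiv (Equiv.inv H) _ _ fun l => ?_
    exact Fintype.sum_equiv (Equiv.mulLeft l) _ _ fun h => rfl
  mul_compr₂_comul := by
    refine basis.ext fun p => basis.ext fun p' => ?_
    obtain ⟨r, h⟩ := p
    obtain ⟨s, g⟩ := p'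
    simp only [basis_apply, LinearMap.compr₂_apply, LinearMap.mul_apply', LinearMap.compl₁₂_apply,
      e_mul_e, comul_e, Finset.sum_mul, Finset.mul_sum, Algebra.TensorProduct.tmul_mul_tmul,
      inv_inj]
    have key : ∀ l : H, (∑ m : H, (if l = m then (e (r * s) l⁻¹ : SmashCoproduct k Γ H) else 0)
        ⊗ₜ[k] (if l * h = m * g then (e (l • r * m • s) (l * h) : SmashCoproduct k Γ H) else 0)) =
        if h = g then e (r * s) l⁻¹ ⊗ₜ[k] e (l • (r * s)) (l * h) else 0 := by
      intro l
      rw [Finset.sum_eq_single l]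
      · split_ifs <;> simp_all
      · intro m _ hm
        simp [Ne.symm hm]
      · simp
    rw [Finset.sum_comm] 
    rw [Finset.sum_congr rfl fun l _ => key l]
    split_ifs <;> simp [comul_e]

/-- The antipode `S(r # δ_h) = h⁻¹.r⁻¹ # δ_{h⁻¹}`. -/
def antipodeMap : SmashCoproduct k Γ H →ₗ[k] SmashCoproduct k Γ H :=
  basis.constr k fun p => e (p.2⁻¹ • p.1⁻¹) p.2⁻¹

theorem antipodeMap_e (r : Γ) (h : H) :
    antipodeMap (e r h : SmashCoproduct k Γ H) = e (h⁻¹ • r⁻¹) h⁻¹ := by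
  rw [← basis_apply r h]
  exact basis.constr_basis k _ (r, h)

instance : HopfAlgebra k (SmashCoproduct k Γ H) where
  antipode := antipodeMap
  mul_antipode_rTensor_comul := by
    refine basis.ext fun p => ?_
    obtain ⟨r, h⟩ := p
    simp only [basis_apply, LinearMap.comp_apply, comul_e, map_sum, LinearMap.rTensor_tmul,
      counit_e, antipodeMap_e, LinearMap.mul'_apply, e_mul_e, Algebra.linearMap_apply,
      Algebra.algebraMap_eq_smul_one, one_eq]
    split_ifs with h1 <;> simp [h1]
  mul_antipode_lTensor_comul := by
    refine basis.ext fun p => ?_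
    obtain ⟨r, h⟩ := p
    simp only [basis_apply, LinearMap.comp_apply, comul_e, map_sum, LinearMap.lTensor_tmul,
      counit_e, antipodeMap_e, LinearMap.mul'_apply, e_mul_e, Algebra.linearMap_apply,
      Algebra.algebraMap_eq_smul_one, one_eq]
    split_ifs with h1
    · subst h1
      simp only [mul_one, if_true, one_smul]
      refine Fintype.sum_equiv (Equiv.inv H) _ _ fun l => ?_
      simp
    · have : ∀ l : H, l⁻¹ ≠ (l * h)⁻¹ := by simpa using h1
      simp only [if_neg (this _), Finset.sum_const_zero, zero_smul]

end SmashCoproduct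

/-! ## Quotient data -/

/-- A quotient datum `(H, N, Φ)` for `H ↷ Γ` whose first entry is the whole group `H`, written
`(N, Φ)`. -/
structure QuotientDatum (k : Type u) (Γ : Type v) (H : Type w) [Field k] [Group Γ] [Group H]
    [MulDistribMulAction H Γ] where
  /-- The subgroup `N` of `Γ`. -/
  N : Subgroup Γ
  normal : N.Normal
  smul_mem : ∀ (h : H) (r : Γ), r ∈ N → h • r ∈ N
  /-- The group morphism `Φ : N → (k^H)ˣ`. -/
  Φ : N →* (H → k)ˣ
  Φ_mul : ∀ (r : N) (l h : H), (Φ r : H → k) (l * h) =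
    (Φ ⟨l⁻¹ • (r : Γ), smul_mem l⁻¹ r r.2⟩ : H → k) h * (Φ r : H → k) l
  Φ_conj : ∀ (r : N) (s : Γ), Φ r = Φ ⟨s * r * s⁻¹, normal.conj_mem r r.2 s⟩

/-- A section `j : Γ/N → Γ` of the canonical projection, with `j(1) = 1`. -/
structure NormalizedSection {Γ : Type v} [Group Γ] (N : Subgroup Γ) where
  /-- The underlying map. -/
  toFun : Γ ⧸ N → Γ
  mk_toFun : ∀ x : Γ ⧸ N, (QuotientGroup.mk (toFun x) : Γ ⧸ N) = x
  map_one : toFun (QuotientGroup.mk 1) = 1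

namespace QuotientDatum

variable {k : Type u} {Γ : Type v} {H : Type w} [Field k] [Group Γ] [Group H]
  [MulDistribMulAction H Γ] (D : QuotientDatum k Γ H)

instance : D.N.Normal := D.normal

/-- The action of `h ∈ H` on `Γ/N` induced by the action on `Γ`. -/
def act (h : H) : Γ ⧸ D.N →* Γ ⧸ D.N :=
  QuotientGroup.map D.N D.N (MulDistribMulAction.toMonoidHom Γ h) fun r hr => D.smul_mem h r hr

theorem act_mk (h : H) (r : Γ) :
    D.act h (QuotientGroup.mk r) = QuotientGroup.mk (h • r) := rfl

theorem act_mul (h g : H) (x : Γ ⧸ D.N) : D.act (h * g) x = D.act h (D.act g x) := by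
  induction x using QuotientGroup.induction_on with
  | H r => simp [act_mk, mul_smul]

theorem act_one (x : Γ ⧸ D.N) : D.act 1 x = x := by
  induction x using QuotientGroup.induction_on with
  | H r => simp [act_mk]

theorem act_inv_act (h : H) (x : Γ ⧸ D.N) : D.act h⁻¹ (D.act h x) = x := by
  rw [← act_mul, inv_mul_cancel, act_one]

open Classical in
/-- Auxiliary extension of `Φ` by zero, used only in proofs. -/
def P (r : Γ) (h : H) : k := if hr : r ∈ D.N then (D.Φ ⟨r, hr⟩ : H → k) h else 0

theorem P_eq (r : Γ) (hr : r ∈ D.N) (h : H) : (D.Φ ⟨r, hr⟩ : H → k) h = D.P r h := by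
  simp [P, hr]

theorem P_one (h : H) : D.P 1 h = 1 := by
  rw [← D.P_eq 1 D.N.one_mem]
  have : (⟨1, D.N.one_mem⟩ : D.N) = 1 := rfl
  rw [this, map_one]
  rfl

theorem P_mul {r s : Γ} (hr : r ∈ D.N) (hs : s ∈ D.N) (h : H) :
    D.P r h * D.P s h = D.P (r * s) h := by
  rw [← D.P_eq r hr, ← D.P_eq s hs, ← D.P_eq _ (D.N.mul_mem hr hs)]
  have : (⟨r * s, D.N.mul_mem hr hs⟩ : D.N) = ⟨r, hr⟩ * ⟨s, hs⟩ := rfl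
  rw [this, map_mul]
  rfl

theorem P_conj {r : Γ} (hr : r ∈ D.N) (s : Γ) (h : H) : D.P (s * r * s⁻¹) h = D.P r h := by
  rw [← D.P_eq r hr, ← D.P_eq _ (D.normal.conj_mem r hr s), ← D.Φ_conj ⟨r, hr⟩ s]

theorem P_comm {r s : Γ} (hr : r * s ∈ D.N) (h : H) : D.P (s * r) h = D.P (r * s) h := by
  rw [← D.P_conj hr s]
  congr 1
  group

theorem P_coc {r : Γ} (hr : r ∈ D.N) (l h : H) :
    D.P r (l * h) = D.P (l⁻¹ • r) h * D.P r l := by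
  rw [← D.P_eq r hr, ← D.P_eq r hr, ← D.P_eq _ (D.smul_mem l⁻¹ r hr)]
  exact D.Φ_mul ⟨r, hr⟩ l h

theorem P_apply_one {r : Γ} (hr : r ∈ D.N) : D.P r (1 : H) = 1 := by
  have h1 := D.P_coc hr 1 1
  have h2 : D.P r (1 : H) * D.P r⁻¹ (1 : H) = 1 := by
    rw [D.P_mul hr (D.N.inv_mem hr), mul_inv_cancel, P_one]
  simp only [mul_one, inv_one, one_smul] at h1
  exact (mul_eq_left₀ (left_ne_zero_of_mul_eq_one h2)).1 h1.symm

/-- `Φ(h.r)(h) = Φ(r⁻¹)(h⁻¹)`. -/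
theorem P_smul {r : Γ} (hr : r ∈ D.N) (h : H) : D.P (h • r) h = D.P r⁻¹ h⁻¹ := by
  have h1 := D.P_coc hr h⁻¹ h
  rw [inv_mul_cancel, D.P_apply_one hr, inv_inv] at h1
  have h2 : D.P r h⁻¹ * D.P r⁻¹ h⁻¹ = 1 := by
    rw [D.P_mul hr (D.N.inv_mem hr), mul_inv_cancel, P_one]
  calc D.P (h • r) h = D.P (h • r) h * (D.P r h⁻¹ * D.P r⁻¹ h⁻¹) := by rw [h2, mul_one]
    _ = D.P r⁻¹ h⁻¹ := by rw [← mul_assoc, ← h1, one_mul]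

theorem P_triple {a b c : Γ} (h1 : a * b⁻¹ ∈ D.N) (h2 : c⁻¹ * a⁻¹ ∈ D.N) (h3 : c * b ∈ D.N)
    (h : H) : D.P (a * b⁻¹) h * D.P (c⁻¹ * a⁻¹) h * D.P (c * b) h = 1 := by
  have h4 : b⁻¹ * a ∈ D.N := D.normal.mem_comm h1
  have h5 : a⁻¹ * c⁻¹ ∈ D.N := D.normal.mem_comm h2
  rw [← D.P_comm h1, ← D.P_comm h2, mul_comm, D.P_mul h4 h5,
    D.P_mul h3 (D.N.mul_mem h4 h5), ← D.P_one h]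
  congr 1
  group

variable (j : NormalizedSection D.N)

theorem mem_of_mk_eq_one {r : Γ} (h : (QuotientGroup.mk r : Γ ⧸ D.N) = 1) : r ∈ D.N :=
  (QuotientGroup.eq_one_iff r).1 h

theorem mem_mul (x y : Γ ⧸ D.N) :
    j.toFun x * j.toFun y * (j.toFun (x * y))⁻¹ ∈ D.N := by
  apply D.mem_of_mk_eq_one
  simp [j.mk_toFun]

theorem mem_act (l : H) (x : Γ ⧸ D.N) :
    (l • j.toFun x) * (j.toFun (D.act l x))⁻¹ ∈ D.N := by
  apply D.mem_of_mk_eq_one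
  rw [QuotientGroup.mk_mul, QuotientGroup.mk_inv, ← act_mk, j.mk_toFun, j.mk_toFun, mul_inv_cancel]

theorem mem_antipode (h : H) (x : Γ ⧸ D.N) :
    (j.toFun (D.act h⁻¹ x⁻¹))⁻¹ * (h⁻¹ • (j.toFun x)⁻¹) ∈ D.N := by
  apply D.mem_of_mk_eq_one
  rw [QuotientGroup.mk_mul, QuotientGroup.mk_inv, ← act_mk, QuotientGroup.mk_inv, j.mk_toFun,
    j.mk_toFun, inv_mul_cancel]

theorem mem_mk (r : Γ) : r * (j.toFun (QuotientGroup.mk r))⁻¹ ∈ D.N := by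
  apply D.mem_of_mk_eq_one
  rw [QuotientGroup.mk_mul, QuotientGroup.mk_inv, j.mk_toFun, mul_inv_cancel]

/-! ## The Hopf algebra `k[Γ/N] ⋊_Φ k^H` -/

/-- The Hopf algebra `k[Γ/N] ⋊_Φ k^H` attached to a quotient datum, formed with the section `j`;
its underlying vector space is `k[Γ/N] ⊗ k^H`. -/
def Twisted (_j : NormalizedSection D.N) : Type _ := GroupTensorFun k (Γ ⧸ D.N) H

namespace Twisted

variable {D} {j}

instance : AddCommGroup (D.Twisted j) := inferInstanceAs (AddCommGroup (GroupTensorFun k _ H))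

instance : Module k (D.Twisted j) := inferInstanceAs (Module k (GroupTensorFun k _ H))

/-- The element `x # f = x ⊗ f` of `k[Γ/N] ⋊_Φ k^H`, for `x ∈ Γ/N` and `f ∈ k^H`. -/
def elt (x : Γ ⧸ D.N) (f : H → k) : D.Twisted j :=
  (MonoidAlgebra.single x (1 : k) ⊗ₜ[k] f : GroupTensorFun k _ H)

instance : One (D.Twisted j) := ⟨elt 1 1⟩

variable [Fintype H] [DecidableEq H]

/-- The basis `x # δ_h` of `k[Γ/N] ⋊_Φ k^H`. -/
def basis : Module.Basis ((Γ ⧸ D.N) × H) k (D.Twisted j) := GroupTensorFun.basis k _ H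

/-- The basis element `x # δ_h`. -/
def e (x : Γ ⧸ D.N) (h : H) : D.Twisted j := elt x (Pi.single h 1)

theorem basis_apply (x : Γ ⧸ D.N) (h : H) : (basis (x, h) : D.Twisted j) = e x h :=
  GroupTensorFun.basis_apply k _ H (x, h)

theorem one_eq : (1 : D.Twisted j) = ∑ h : H, e 1 h := by
  change (MonoidAlgebra.single 1 1 ⊗ₜ[k] (1 : H → k) : GroupTensorFun k (Γ ⧸ D.N) H) =
    ∑ h : H, (MonoidAlgebra.single 1 (1 : k) ⊗ₜ[k] (Pi.single h 1) : GroupTensorFun k _ H)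
  rw [← TensorProduct.tmul_sum, Finset.univ_sum_single (1 : H → k) |>.symm]
  rfl

/-- The product
`(x # δ_h)(y # δ_g) = xy # δ_h δ_g Φ(j(x) j(y) j(xy)⁻¹)`, as a bilinear map. -/
def mulMap : D.Twisted j →ₗ[k] D.Twisted j →ₗ[k] D.Twisted j :=
  basis.constr k fun p => basis.constr k fun q =>
    elt (p.1 * q.1) (Pi.single p.2 1 * Pi.single q.2 1 *
      (D.Φ ⟨j.toFun p.1 * j.toFun q.1 * (j.toFun (p.1 * q.1))⁻¹, D.mem_mul j p.1 q.1⟩ : H → k))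

instance : Mul (D.Twisted j) := ⟨fun a b => mulMap a b⟩

theorem elt_smul (x : Γ ⧸ D.N) (c : k) (f : H → k) : (elt x (c • f) : D.Twisted j) = c • elt x f :=
  TensorProduct.tmul_smul c (MonoidAlgebra.single x (1 : k)) f

theorem elt_single_mul (x : Γ ⧸ D.N) (h : H) (f : H → k) :
    (elt x (Pi.single h 1 * f) : D.Twisted j) = f h • e x h := by
  rw [e, ← elt_smul]
  congr 1
  ext a
  by_cases ha : a = h
  · subst ha
    simp
  · simp [ha]

theorem mulMap_e_e (x y : Γ ⧸ D.N) (h g : H) : mulMap (e x h : D.Twisted j) (e y g) =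
    if h = g then D.P (j.toFun x * j.toFun y * (j.toFun (x * y))⁻¹) h • e (x * y) h else 0 := by
  have h1 : mulMap (e x h : D.Twisted j) (e y g) = elt (x * y) (Pi.single h 1 * Pi.single g 1 *
      (D.Φ ⟨j.toFun x * j.toFun y * (j.toFun (x * y))⁻¹, D.mem_mul j x y⟩ : H → k)) := by
    rw [← basis_apply x h, ← basis_apply y g, mulMap, Module.Basis.constr_basis,
      Module.Basis.constr_basis]
  rw [h1, mul_assoc, elt_single_mul, Pi.mul_apply, P_eq]
  split_ifs with hg
  · subst hg
    simp
  · simp [hg]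

theorem mul_def (a b : D.Twisted j) : a * b = mulMap a b := rfl

theorem e_mul_e (x y : Γ ⧸ D.N) (h g : H) : (e x h : D.Twisted j) * e y g =
    if h = g then D.P (j.toFun x * j.toFun y * (j.toFun (x * y))⁻¹) h • e (x * y) h else 0 :=
  mulMap_e_e x y h g

theorem toFun_one : j.toFun 1 = 1 := j.map_one

theorem one_mul' (a : D.Twisted j) : mulMap 1 a = a := by
  suffices h : mulMap (1 : D.Twisted j) = LinearMap.id from LinearMap.congr_fun h a
  refine basis.ext fun p => ?_
  obtain ⟨x, h⟩ := p
  rw [basis_apply, one_eq, map_sum, LinearMap.sum_apply]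
  simp [mulMap_e_e, toFun_one, P_one]

theorem mul_one' (a : D.Twisted j) : mulMap a 1 = a := by
  suffices h : mulMap.flip (1 : D.Twisted j) = LinearMap.id from LinearMap.congr_fun h a
  refine basis.ext fun p => ?_
  obtain ⟨x, h⟩ := p
  rw [basis_apply, one_eq, map_sum, LinearMap.sum_apply]
  simp [mulMap_e_e, toFun_one, P_one]

theorem mul_assoc' (a b c : D.Twisted j) : mulMap (mulMap a b) c = mulMap a (mulMap b c) := by
  suffices h : LinearMap.compr₂ mulMap mulMap =
      LinearMap.compl₂ (LinearMap.llcomp k (D.Twisted j) _ _ ∘ₗ mulMap) mulMap from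
    LinearMap.congr_fun (LinearMap.congr_fun (LinearMap.congr_fun h a) b) c
  refine basis.ext fun p => basis.ext fun p' => basis.ext fun p'' => ?_
  obtain ⟨x, h⟩ := p
  obtain ⟨y, g⟩ := p'
  obtain ⟨z, f⟩ := p''
  simp only [basis_apply, LinearMap.compr₂_apply, LinearMap.compl₂_apply, LinearMap.comp_apply,
    LinearMap.llcomp_apply, mulMap_e_e]
  by_cases hg : h = g
  · subst hg
    by_cases hf : h = f
    · subst hf
      simp only [if_true, map_smul, LinearMap.smul_apply, mulMap_e_e, smul_smul, mul_assoc x y z]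
      congr 1
      have h1 := D.mem_mul j x y
      have h2 := D.mem_mul j (x * y) z
      have h3 := D.mem_mul j y z
      have h4 := D.mem_mul j x (y * z)
      rw [mul_assoc x y z] at h2
      rw [← D.P_conj h3 (j.toFun x), D.P_mul h1 h2, D.P_mul (D.normal.conj_mem _ h3 _) h4]
      congr 1
      group
    · simp [hf, mulMap_e_e]
  · simp only [if_neg hg, map_zero, LinearMap.zero_apply]
    by_cases hf : g = f
    · simp [hf, mulMap_e_e]
      intro h'
      exact absurd (h'.trans hf.symm) hg
    · simp [hf]

instance : Ring (D.Twisted j) where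
  __ := (inferInstance : AddCommGroup (D.Twisted j))
  left_distrib a b c := map_add (mulMap a) b c
  right_distrib a b c := LinearMap.map_add₂ mulMap a b c
  zero_mul a := LinearMap.map_zero₂ mulMap a
  mul_zero a := map_zero (mulMap a)
  one_mul := one_mul'
  mul_one := mul_one'
  mul_assoc := mul_assoc'

instance : Algebra k (D.Twisted j) :=
  Algebra.ofModule (fun c a b => LinearMap.map_smul₂ mulMap c a b)
    fun c a b => map_smul (mulMap a) c b

variable (D j) in
/-- The coefficient `Φ(l.j(x) j(l.x)⁻¹)` of the comultiplication. -/
def comulCoeff (l : H) (x : Γ ⧸ D.N) : H → k :=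
  D.Φ ⟨(l • j.toFun x) * (j.toFun (D.act l x))⁻¹, D.mem_act j l x⟩

variable (D j) in
/-- The coefficient `Φ(j(h⁻¹.x⁻¹)⁻¹ h⁻¹.j(x)⁻¹)` of the antipode. -/
def antipodeCoeff (h : H) (x : Γ ⧸ D.N) : H → k :=
  D.Φ ⟨(j.toFun (D.act h⁻¹ x⁻¹))⁻¹ * (h⁻¹ • (j.toFun x)⁻¹), D.mem_antipode j h x⟩

/-- `Δ(x # δ_h) = ∑_l (x # δ_{l⁻¹}) ⊗ (l.x # δ_{lh} Φ(l.j(x) j(l.x)⁻¹))` and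
`ε(x # δ_h) = δ_{h,1}`. -/
instance : CoalgebraStruct k (D.Twisted j) where
  comul := basis.constr k fun p => ∑ l : H,
    e p.1 l⁻¹ ⊗ₜ[k] elt (D.act l p.1) (Pi.single (l * p.2) 1 * comulCoeff D j l p.1)
  counit := basis.constr k fun p => if p.2 = 1 then 1 else 0

open Coalgebra

theorem comul_e (x : Γ ⧸ D.N) (h : H) : comul (R := k) (e x h : D.Twisted j) =
    ∑ l : H, D.P ((l • j.toFun x) * (j.toFun (D.act l x))⁻¹) (l * h) •
      (e x l⁻¹ ⊗ₜ[k] e (D.act l x) (l * h)) := by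
  rw [← basis_apply]
  refine (basis.constr_basis k _ (x, h)).trans ?_
  refine Finset.sum_congr rfl fun l _ => ?_
  rw [elt_single_mul, TensorProduct.tmul_smul, comulCoeff, P_eq]

theorem counit_e (x : Γ ⧸ D.N) (h : H) :
    counit (R := k) (e x h : D.Twisted j) = if h = 1 then 1 else 0 := by
  rw [← basis_apply]
  exact basis.constr_basis k _ (x, h)

instance : Coalgebra k (D.Twisted j) where
  coassoc := by
    refine basis.ext fun p => ?_
    obtain ⟨x, h⟩ := p
    simp only [basis_apply, LinearMap.comp_apply, LinearEquiv.coe_coe, comul_e, map_sum, map_smul,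
      LinearMap.rTensor_tmul, LinearMap.lTensor_tmul, TensorProduct.sum_tmul,
      TensorProduct.tmul_sum, TensorProduct.assoc_tmul, Finset.smul_sum, TensorProduct.tmul_smul,
      ← TensorProduct.smul_tmul', smul_smul]
    rw [Finset.sum_comm]
    refine Finset.sum_congr rfl fun m _ => ?_
    refine Fintype.sum_equiv (Equiv.mulRight m⁻¹) _ _ fun l => ?_
    have e1 : D.act (l * m⁻¹) (D.act m x) = D.act l x := by
      rw [← D.act_mul, inv_mul_cancel_right]
    simp only [Equiv.coe_mulRight, e1, mul_inv_rev, inv_inv]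
    congr 1
    · have h1 := D.mem_act j l x
      have h2 := D.mem_act j m x
      have h3 := D.mem_act j (l * m⁻¹) (D.act m x)
      rw [e1] at h3
      have h4 := D.smul_mem (l * m⁻¹) _ h2
      have c := D.P_coc h2 (m * l⁻¹) (l * h)
      have e2 : m * l⁻¹ * (l * h) = m * h := by group
      have e3 : l * m⁻¹ * (m * h) = l * h := by group
      rw [e2, mul_inv_rev, inv_inv] at c
      rw [c, e3, mul_right_comm, D.P_mul h4 h3]
      congr 2
      simp [smul_mul', smul_inv', mul_smul]
    · have e3 : l * m⁻¹ * (m * h) = l * h := by group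
      rw [e3]
  rTensor_counit_comp_comul := by
    refine basis.ext fun p => ?_
    obtain ⟨x, h⟩ := p
    simp only [basis_apply, LinearMap.comp_apply, comul_e, map_sum, map_smul,
      LinearMap.rTensor_tmul, counit_e, inv_eq_one]
    rw [Finset.sum_eq_single 1] <;> simp +contextual [act_one, P_one]
  lTensor_counit_comp_comul := by
    refine basis.ext fun p => ?_
    obtain ⟨x, h⟩ := p
    simp only [basis_apply, LinearMap.comp_apply, comul_e, map_sum, map_smul,
      LinearMap.lTensor_tmul, counit_e, mul_eq_one_iff_eq_inv]
    rw [Finset.sum_eq_single h⁻¹] <;>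
      simp +contextual [D.P_apply_one (D.mem_act j h⁻¹ x)]

instance : Bialgebra k (D.Twisted j) where
  counit_one := by
    rw [one_eq, map_sum]
    simp [counit_e]
  mul_compr₂_counit := by
    refine basis.ext fun p => basis.ext fun p' => ?_
    obtain ⟨x, h⟩ := p
    obtain ⟨y, g⟩ := p'
    simp only [basis_apply, LinearMap.compr₂_apply, LinearMap.mul_apply', LinearMap.compl₁₂_apply,
      e_mul_e, counit_e]
    have := D.P_apply_one (D.mem_mul j x y)
    split_ifs <;> simp_all [counit_e]
  comul_one := by
    rw [one_eq, map_sum, Algebra.TensorProduct.one_def, one_eq]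
    simp only [comul_e, map_one, toFun_one, smul_one, inv_one, mul_one, P_one, one_smul,
      TensorProduct.sum_tmul, TensorProduct.tmul_sum]
    rw [Finset.sum_comm]
    conv_rhs => rw [Finset.sum_comm]
    refine Fintype.sum_equiv (Equiv.inv H) _ _ fun l => ?_
    exact Fintype.sum_equiv (Equiv.mulLeft l) _ _ fun h => rfl
  mul_compr₂_comul := by
    refine basis.ext fun p => basis.ext fun p' => ?_
    obtain ⟨x, h⟩ := p
    obtain ⟨y, g⟩ := p'
    simp only [basis_apply, LinearMap.compr₂_apply, LinearMap.mul_apply', LinearMap.compl₁₂_apply,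
      e_mul_e, comul_e, Finset.sum_mul, Finset.mul_sum, Algebra.TensorProduct.tmul_mul_tmul,
      inv_inj, smul_mul_smul_comm]
    rw [Finset.sum_comm]
    by_cases hg : h = g
    · subst hg
      simp only [if_true, map_smul, comul_e, Finset.smul_sum]
      refine Finset.sum_congr rfl fun l _ => ?_
      rw [Finset.sum_eq_single l]
      · simp only [if_true, ← TensorProduct.smul_tmul', TensorProduct.tmul_smul, smul_smul, map_mul]
        congr 1
        have m1 := D.mem_mul j x y
        have m2 := D.mem_act j l (x * y)
        have m3 := D.mem_act j l x
        have m4 := D.mem_act j l y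
        have m5 := D.mem_mul j (D.act l x) (D.act l y)
        have m6 := D.smul_mem l _ m1
        have c := D.P_coc m1 l⁻¹ (l * h)
        rw [inv_mul_cancel_left, inv_inv] at c
        rw [map_mul] at m2
        have q : D.P (l • (j.toFun x * j.toFun y * (j.toFun (x * y))⁻¹)) (l * h) *
            D.P (l • j.toFun (x * y) * (j.toFun (D.act l x * D.act l y))⁻¹) (l * h) =
            D.P (l • j.toFun x * (j.toFun (D.act l x))⁻¹) (l * h) *
            D.P (l • j.toFun y * (j.toFun (D.act l y))⁻¹) (l * h) *
            D.P (j.toFun (D.act l x) * j.toFun (D.act l y) *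
              (j.toFun (D.act l x * D.act l y))⁻¹) (l * h) := by
          have m4' := D.normal.conj_mem _ m4 (j.toFun (D.act l x))
          rw [← D.P_conj m4 (j.toFun (D.act l x)), D.P_mul m6 m2, D.P_mul m3 m4',
            D.P_mul (D.N.mul_mem m3 m4') m5]
          congr 1
          simp only [smul_mul', smul_inv']
          group
        rw [c, mul_right_comm, q]
        ring
      · intro m _ hm
        simp [Ne.symm hm]
      · simp
    · simp only [if_neg hg, map_zero]
      symm
      refine Finset.sum_eq_zero fun l _ => Finset.sum_eq_zero fun m _ => ?_
      by_cases hm : l = m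
      · subst hm
        simp [hg]
      · simp [hm]

/-- The antipode `S(x # δ_h) = h⁻¹.x⁻¹ # Φ(j(h⁻¹.x⁻¹)⁻¹ h⁻¹.j(x)⁻¹) δ_{h⁻¹}`. -/
def antipodeMap : D.Twisted j →ₗ[k] D.Twisted j :=
  basis.constr k fun p =>
    elt (D.act p.2⁻¹ p.1⁻¹) (antipodeCoeff D j p.2 p.1 * Pi.single p.2⁻¹ 1)

theorem antipodeMap_e (x : Γ ⧸ D.N) (h : H) : antipodeMap (e x h : D.Twisted j) =
    D.P ((j.toFun (D.act h⁻¹ x⁻¹))⁻¹ * (h⁻¹ • (j.toFun x)⁻¹)) h⁻¹ • e (D.act h⁻¹ x⁻¹) h⁻¹ := by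
  rw [← basis_apply x h]
  refine (basis.constr_basis k _ (x, h)).trans ?_
  rw [mul_comm, elt_single_mul, antipodeCoeff, P_eq]

instance : HopfAlgebra k (D.Twisted j) where
  antipode := antipodeMap
  mul_antipode_rTensor_comul := by
    refine basis.ext fun p => ?_
    obtain ⟨x, h⟩ := p
    simp only [basis_apply, LinearMap.comp_apply, comul_e, map_sum, map_smul,
      LinearMap.rTensor_tmul, counit_e, antipodeMap_e, LinearMap.mul'_apply, e_mul_e,
      smul_mul_assoc, Algebra.linearMap_apply, Algebra.algebraMap_eq_smul_one, one_eq, inv_inv]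
    by_cases h1 : h = 1
    · subst h1
      simp only [mul_one, if_true, one_smul]
      refine Finset.sum_congr rfl fun l _ => ?_
      have m1 := D.mem_act j l x
      have m2 := D.mem_antipode j l⁻¹ x
      have m3 := D.mem_mul j (D.act l x⁻¹) (D.act l x)
      have e1 : D.act l x⁻¹ * D.act l x = 1 := by rw [← map_mul, inv_mul_cancel, map_one]
      rw [inv_inv] at m2
      rw [e1] at m3
      rw [toFun_one, inv_one, mul_one] at m3
      rw [smul_inv'] at m2
      rw [e1, smul_smul, smul_smul, toFun_one, inv_one, mul_one, smul_inv', D.P_triple m1 m2 m3,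
        one_smul]
    · have : ∀ l : H, l ≠ l * h := by simpa using h1
      simp only [if_neg (this _), if_neg h1, smul_zero, Finset.sum_const_zero, zero_smul]
  mul_antipode_lTensor_comul := by
    refine basis.ext fun p => ?_
    obtain ⟨x, h⟩ := p
    simp only [basis_apply, LinearMap.comp_apply, comul_e, map_sum, map_smul,
      LinearMap.lTensor_tmul, counit_e, antipodeMap_e, LinearMap.mul'_apply, e_mul_e,
      mul_smul_comm, Algebra.linearMap_apply, Algebra.algebraMap_eq_smul_one, one_eq]
    by_cases h1 : h = 1
    · subst h1
      simp only [mul_one, if_true, one_smul]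
      refine Fintype.sum_equiv (Equiv.inv H) _ _ fun l => ?_
      have m1 := D.mem_act j l x
      have m2 := D.mem_antipode j l (D.act l x)
      have m3 := D.mem_mul j x x⁻¹
      have e1 : D.act l⁻¹ (D.act l x)⁻¹ = x⁻¹ := by rw [map_inv, act_inv_act]
      have m4 := D.smul_mem l⁻¹ _ m1
      have e2 : l • j.toFun x * (j.toFun (D.act l x))⁻¹ =
          l • (j.toFun x * (l⁻¹ • j.toFun (D.act l x))⁻¹) := by
        simp [smul_mul', smul_inv']
      rw [e2, inv_smul_smul] at m4
      rw [e1, smul_inv'] at m2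
      rw [mul_inv_cancel, toFun_one, inv_one, mul_one] at m3
      have m5 := D.N.inv_mem m4
      rw [mul_inv_rev, inv_inv] at m5
      rw [e1, e2, D.P_smul m4, smul_smul, smul_smul, mul_inv_cancel, toFun_one,
        inv_one, mul_one, smul_inv', mul_inv_rev, inv_inv, ← D.P_comm m3,
        D.P_triple m5 m2 (D.normal.mem_comm m3), one_smul, Equiv.inv_apply]
    · have : ∀ l : H, l⁻¹ ≠ (l * h)⁻¹ := by simpa using h1
      simp only [if_neg (this _), if_neg h1, smul_zero, Finset.sum_const_zero, zero_smul]

end Twisted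

end QuotientDatum

/-! ## Hopf images -/

section HopfImage

universe a b c d

variable {k : Type u} [Field k] {A : Type a} [Ring A] [HopfAlgebra k A] {R : Type b} [Ring R]
  [Algebra k R]

/-- `(L, q, φ)` is a factorization of the algebra map `ρ : A → R` through the Hopf algebra `L`:
`q : A → L` is a surjective Hopf algebra map, `φ : L → R` is an algebra map, and `ρ = φ ∘ q`. -/
structure IsHopfFactorization {L : Type c} [Ring L] [HopfAlgebra k L] (ρ : A →ₐ[k] R)
    (q : A →ₐc[k] L) (φ : L →ₐ[k] R) : Prop where
  surjective : Function.Surjective q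
  factors : ∀ a : A, φ (q a) = ρ a

/-- `(L, p, φ)` is the Hopf image of `ρ`: the final object among the factorizations `(M, q, ψ)`
of `ρ` (with `M` in an arbitrary universe `d`). -/
structure IsHopfImage {L : Type c} [Ring L] [HopfAlgebra k L] (ρ : A →ₐ[k] R)
    (p : A →ₐc[k] L) (φ : L →ₐ[k] R) : Prop where
  isHopfFactorization : IsHopfFactorization ρ p φ
  existsUnique : ∀ (M : Type d) [Ring M] [HopfAlgebra k M] (q : A →ₐc[k] M) (ψ : M →ₐ[k] R),
    IsHopfFactorization ρ q ψ →
      ∃! f : M →ₐc[k] L, (∀ a : A, f (q a) = p a) ∧ ∀ m : M, φ (f m) = ψ m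

end HopfImage

/-- The set `E(ρ)` of quotient data `(N, Φ)` with `ρ(r # 1) = ρ(1 # Φ(r))` for all `r ∈ N`. -/
def compatibleData {k : Type u} {Γ : Type v} {H : Type w} {R : Type x} [Field k] [Group Γ]
    [Group H] [MulDistribMulAction H Γ] [Ring R] [Algebra k R]
    (ρ : SmashCoproduct k Γ H →ₐ[k] R) : Set (QuotientDatum k Γ H) :=
  {D | ∀ r : D.N, ρ (.elt (r : Γ) 1) = ρ (.elt 1 (D.Φ r : H → k))}

end

/-!
For a quotient datum `D` in `E(ρ)`, the map `ρ` factors through the projection of `k[Γ] ⋊ k^H` onto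
the twisted Hopf algebra of `D`, so the point is that the largest datum `(N, Φ_{|N})` gives the
final factorization. Let `q` be the projection of any factorization of `ρ`; it is injective on
`k^H`, so it has a largest datum `D'` of its own. Since `q` respects the comultiplication, the part
of `Δ(r # f)` whose left factor lies over `δ_m` gives two facts. The elements which `q` identifies
with functions form an `H`-stable subgroup on which the cocycle identity is automatic, hence are
exactly those of `D'`. Moreover the elements `q(r # δ_1)` are group-like for the component `m = 1`,
so that those of distinct cosets modulo `D'` are linearly independent, and `q` has the same kernel
as the projection attached to `D'`. As `D'` lies in `E(ρ)`, it is contained in the largest datum of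
`ρ`, whose projection therefore factors through `q`.
-/

section LinearAlgebra

variable {K V W ι : Type*} [Field K] [AddCommGroup V] [Module K V] [AddCommGroup W] [Module K W]

theorem tmul_right_injective_of_ne_zero {a : V} (ha : a ≠ 0) :
    Function.Injective fun b : W => a ⊗ₜ[K] b := by
  obtain ⟨φ, hφ⟩ := Module.Projective.exists_dual_eq_one K ha
  intro b b' h
  simpa [hφ] using congrArg (TensorProduct.lid K W ∘ φ.rTensor W) h

theorem exists_eq_smul_of_tmul_eq_tmul {a a' : V} {b b' : W} (hb : b ≠ 0)
    (h : a ⊗ₜ[K] b = a' ⊗ₜ[K] b') : ∃ c : K, a = c • a' := by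
  obtain ⟨φ, hφ⟩ := Module.Projective.exists_dual_eq_one K hb
  refine ⟨φ b', ?_⟩
  simpa [hφ] using congrArg (TensorProduct.rid K V ∘ φ.lTensor V) h

theorem eq_zero_of_sum_tmul_eq_zero {v : ι → V} {s : Finset ι} (hv : LinearIndepOn K v s)
    {w : ι → W} (h : ∑ i ∈ s, v i ⊗ₜ[K] w i = 0) : ∀ i ∈ s, w i = 0 := by
  classical
  obtain ⟨G, hG⟩ := LinearMap.exists_leftInverse_of_injective
    (Finsupp.linearCombination K fun i : s => v i) (LinearMap.ker_eq_bot.2 hv)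
  have hGv (i : s) : G (v i) = Finsupp.single i 1 := by
    simpa using LinearMap.congr_fun hG (Finsupp.single i 1)
  intro i hi
  have := congrArg (TensorProduct.lid K W ∘ (Finsupp.lapply ⟨i, hi⟩ ∘ₗ G).rTensor W) h
  rw [← Finset.sum_coe_sort] at this
  simpa [hGv, Finsupp.single_apply] using this

theorem linearIndependent_of_map_eq_tmul_self {v : ι → V} (hv : Function.Injective v)
    (hv₀ : ∀ i, v i ≠ 0) (T : V →ₗ[K] V ⊗[K] V) (hT : ∀ i, T (v i) = v i ⊗ₜ[K] v i) :
    LinearIndependent K v := by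
  rw [← linearIndepOn_univ_iff, linearIndepOn_iff_linearIndepOn_finset]
  intro s _
  induction s using Finset.cons_induction with
  | empty => simp
  | cons a s ha ih =>
    rw [Finset.coe_cons]
    refine (ih (Set.subset_univ _)).insert fun hspan => ?_
    obtain ⟨c, hc⟩ := Submodule.mem_span_image_finset_iff_exists_fun' (R := K).1 hspan
    have hsum : ∑ i ∈ s, v i ⊗ₜ[K] (c i • (v i - v a)) = 0 := calc
      _ = T (∑ i ∈ s, c i • v i) - (∑ i ∈ s, c i • v i) ⊗ₜ[K] v a := by
        simp only [map_sum, map_smul, hT, TensorProduct.sum_tmul, ← TensorProduct.smul_tmul',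
          ← Finset.sum_sub_distrib, ← smul_sub, ← TensorProduct.tmul_sub, TensorProduct.tmul_smul]
      _ = 0 := by rw [hc, hT, sub_self]
    have hc₀ : ∀ i ∈ s, c i = 0 := fun i hi =>
      have hi₀ := eq_zero_of_sum_tmul_eq_zero (ih (Set.subset_univ _)) hsum i hi
      (smul_eq_zero.1 hi₀).resolve_right (sub_ne_zero.2 fun h => ha (hv h ▸ hi))
    exact hv₀ a (hc ▸ Finset.sum_eq_zero fun i hi => by rw [hc₀ i hi, zero_smul])

end LinearAlgebra

theorem exists_bialgHom_comp_eq {K A B C : Type*} [CommRing K] [Ring A] [Ring B] [Ring C]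
    [Bialgebra K A] [Bialgebra K B] [Bialgebra K C] (q : A →ₐc[K] B)
    (hq : Function.Surjective q) (p : A →ₐc[K] C) (hker : ∀ a, q a = 0 → p a = 0) :
    ∃ f : B →ₐc[K] C, ∀ a, f (q a) = p a := by
  let qₐ : A →ₐ[K] B := q
  let F : B →ₐ[K] C := (Ideal.Quotient.liftₐ (RingHom.ker qₐ) (p : A →ₐ[K] C) hker).comp
    (Ideal.quotientKerAlgEquivOfSurjective (f := qₐ) hq).symm.toAlgHom
  have hF : F.comp qₐ = p := AlgHom.ext fun a =>
    congrArg (Ideal.Quotient.liftₐ (RingHom.ker qₐ) (p : A →ₐ[K] C) hker)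
      (Ideal.quotientKerAlgEquivOfSurjective_symm_apply hq a)
  refine ⟨BialgHom.ofAlgHom F ?_ ?_, AlgHom.congr_fun hF⟩
  · rw [← AlgHom.cancel_right (f := qₐ) hq, AlgHom.comp_assoc, hF, BialgHom.counitAlgHom_comp,
      BialgHom.counitAlgHom_comp]
  · rw [← AlgHom.cancel_right (f := qₐ) hq, AlgHom.comp_assoc, AlgHom.comp_assoc, hF,
      ← BialgHom.map_comp_comulAlgHom p, ← BialgHom.map_comp_comulAlgHom q, ← AlgHom.comp_assoc,
      ← Algebra.TensorProduct.map_comp, hF]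

namespace SmashCoproduct

variable {k : Type u} {Γ : Type v} {H : Type w} [Field k] [Group Γ]

theorem elt_mul_elt (r s : Γ) (f g : H → k) :
    (elt r f * elt s g : SmashCoproduct k Γ H) = elt (r * s) (f * g) := by
  change (MonoidAlgebra.single r (1 : k) ⊗ₜ[k] f : GroupTensorFun k Γ H) *
    (MonoidAlgebra.single s (1 : k) ⊗ₜ[k] g : GroupTensorFun k Γ H) = _
  rw [Algebra.TensorProduct.tmul_mul_tmul, MonoidAlgebra.single_mul_single, one_mul]
  rfl

/-- The embedding `r ↦ r # 1` of the group `Γ` into `k[Γ] ⋊ k^H`. -/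
noncomputable def ofGroup : Γ →* SmashCoproduct k Γ H where
  toFun r := elt r 1
  map_one' := rfl
  map_mul' r s := by rw [elt_mul_elt, mul_one]

/-- The embedding `f ↦ 1 # f` of the function algebra `k^H` into `k[Γ] ⋊ k^H`. -/
noncomputable def ofFun : (H → k) →ₐ[k] SmashCoproduct k Γ H :=
  (Algebra.TensorProduct.includeRight : (H → k) →ₐ[k] GroupTensorFun k Γ H)

theorem elt_eq_ofGroup_mul_ofFun (r : Γ) (f : H → k) :
    (elt r f : SmashCoproduct k Γ H) = ofGroup r * ofFun f := by
  refine Eq.trans ?_ (elt_mul_elt r 1 1 f).symm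
  rw [mul_one, one_mul]

theorem elt_smul (r : Γ) (c : k) (f : H → k) :
    (elt r (c • f) : SmashCoproduct k Γ H) = c • elt r f := by
  rw [elt_eq_ofGroup_mul_ofFun, map_smul, mul_smul_comm, ← elt_eq_ofGroup_mul_ofFun]

variable [DecidableEq H]

theorem elt_mul_e (r s : Γ) (f : H → k) (h : H) :
    (elt r f * e s h : SmashCoproduct k Γ H) = f h • e (r * s) h := by
  have hf : f * Pi.single h 1 = f h • Pi.single h 1 := by
    ext g
    rcases eq_or_ne g h with rfl | hg
    · rfl
    · simp [hg]
  rw [e, elt_mul_elt, hf, elt_smul, e]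

variable [Fintype H]

theorem elt_eq_sum (r : Γ) (f : H → k) :
    (elt r f : SmashCoproduct k Γ H) = ∑ h, f h • e r h := by
  have hf : ∑ h, f h • (Pi.single h 1 : H → k) = f := by
    simpa only [Pi.basisFun_repr, Pi.basisFun_apply] using (Pi.basisFun k H).sum_repr f
  calc elt r f = ofGroup r * ofFun (∑ h, f h • Pi.single h 1) := by
        rw [hf, elt_eq_ofGroup_mul_ofFun]
    _ = ∑ h, f h • e r h := by
        simp only [map_sum, map_smul, Finset.mul_sum, mul_smul_comm, ← elt_eq_ofGroup_mul_ofFun, e]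

variable [Group H] [MulDistribMulAction H Γ]

open Coalgebra

theorem e_one_tmul_one_mul_comul_e (m h : H) (r : Γ) :
    (e 1 m ⊗ₜ[k] 1 : SmashCoproduct k Γ H ⊗[k] SmashCoproduct k Γ H) * comul (e r h) =
      e r m ⊗ₜ[k] e (m⁻¹ • r) (m⁻¹ * h) := by
  simp only [comul_e, Finset.mul_sum, Algebra.TensorProduct.tmul_mul_tmul, e_mul_e, one_mul]
  rw [Finset.sum_eq_single m⁻¹]
  · rw [inv_inv, if_pos rfl]
  · intro l _ hl
    rw [if_neg fun h' => hl (by rw [h', inv_inv]), TensorProduct.zero_tmul]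
  · exact fun hm => absurd (Finset.mem_univ m⁻¹) hm

theorem e_one_tmul_one_mul_comul_elt (m : H) (r : Γ) (f : H → k) :
    (e 1 m ⊗ₜ[k] 1 : SmashCoproduct k Γ H ⊗[k] SmashCoproduct k Γ H) * comul (elt r f) =
      e r m ⊗ₜ[k] elt (m⁻¹ • r) fun h => f (m * h) := by
  simp only [elt_eq_sum, map_sum, map_smul, Finset.mul_sum, mul_smul_comm,
    e_one_tmul_one_mul_comul_e, TensorProduct.tmul_sum, TensorProduct.tmul_smul]
  refine Fintype.sum_equiv (Equiv.mulLeft m⁻¹) _ _ fun h => ?_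
  rw [Equiv.coe_mulLeft, mul_inv_cancel_left]

end SmashCoproduct

namespace QuotientDatum

variable {k : Type u} {Γ : Type v} {H : Type w} {R : Type x} [Field k] [Group Γ] [Group H]
  [MulDistribMulAction H Γ] [Ring R] [Algebra k R] {ρ : SmashCoproduct k Γ H →ₐ[k] R}
  {D D' : QuotientDatum k Γ H}

/-- `(N, Φ) ≤ (N', Φ')` when `N ⊆ N'` and `Φ'` extends `Φ`. The Hopf image of `ρ` comes from the
greatest element of `E(ρ)` for this relation. -/
instance : LE (QuotientDatum k Γ H) where
  le D D' := ∃ h : D.N ≤ D'.N, D'.Φ.comp (Subgroup.inclusion h) = D.Φ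

theorem mem_compatibleData_of_le (h : D ≤ D') (hD' : D' ∈ compatibleData ρ) :
    D ∈ compatibleData ρ := by
  obtain ⟨hN, hΦ⟩ := h
  intro r
  rw [← hΦ]
  exact hD' (Subgroup.inclusion hN r)

variable [DecidableEq H]

theorem map_e_mul_of_mem_compatibleData (hD : D ∈ compatibleData ρ) {n : Γ} (hn : n ∈ D.N) (r : Γ)
    (h : H) : ρ (.e (n * r) h) = D.P n h • ρ (.e r h) := by
  have h_mul := congrArg (· * ρ (.e r h)) (hD ⟨n, hn⟩)
  simpa [← map_mul, SmashCoproduct.elt_mul_e, P_eq] using h_mul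

end QuotientDatum

namespace QuotientDatum.Twisted

variable {k : Type u} {Γ : Type v} {H : Type w} [Field k] [Group Γ] [Group H]
  [MulDistribMulAction H Γ] {D : QuotientDatum k Γ H} {j : NormalizedSection D.N}

theorem exists_finsupp_sum_elt_eq (z : D.Twisted j) :
    ∃ F : Γ ⧸ D.N →₀ (H → k), F.sum elt = z := by
  obtain ⟨F, hF⟩ := TensorProduct.eq_repr_basis_left (MonoidAlgebra.basis (Γ ⧸ D.N) k)
    (show GroupTensorFun k (Γ ⧸ D.N) H from z)
  exact ⟨F, hF⟩

variable [Fintype H] [DecidableEq H]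

theorem elt_eq_sum (x : Γ ⧸ D.N) (f : H → k) : (elt x f : D.Twisted j) = ∑ h, f h • e x h := by
  have hf : f = ∑ h, f h • (Pi.single h 1 : H → k) := by
    simpa only [Pi.basisFun_repr, Pi.basisFun_apply] using ((Pi.basisFun k H).sum_repr f).symm
  conv_lhs => rw [hf]
  exact (TensorProduct.tmul_sum _ _ _).trans
    (Finset.sum_congr rfl fun h _ => TensorProduct.tmul_smul _ _ _)

variable (D j)

/-- The linear map `r # δ_h ↦ u(r) # δ_h Φ(r j(u(r))⁻¹)`. -/
noncomputable def quotientLinearMap : SmashCoproduct k Γ H →ₗ[k] D.Twisted j :=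
  SmashCoproduct.basis.constr k fun p =>
    D.P (p.1 * (j.toFun (QuotientGroup.mk p.1))⁻¹) p.2 • e (QuotientGroup.mk p.1) p.2

theorem quotientLinearMap_e (r : Γ) (h : H) : quotientLinearMap D j (SmashCoproduct.e r h) =
    D.P (r * (j.toFun (QuotientGroup.mk r))⁻¹) h • e (QuotientGroup.mk r) h := by
  rw [← SmashCoproduct.basis_apply]
  exact SmashCoproduct.basis.constr_basis k _ (r, h)

theorem quotientLinearMap_one : quotientLinearMap D j 1 = 1 := by
  rw [SmashCoproduct.one_eq, one_eq, map_sum]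
  refine Finset.sum_congr rfl fun h _ => ?_
  rw [quotientLinearMap_e, QuotientGroup.mk_one, toFun_one, inv_one, mul_one, P_one, one_smul]

theorem quotientLinearMap_mul (a b : SmashCoproduct k Γ H) :
    quotientLinearMap D j (a * b) = quotientLinearMap D j a * quotientLinearMap D j b := by
  suffices h : (LinearMap.mul k (SmashCoproduct k Γ H)).compr₂ (quotientLinearMap D j) =
      (LinearMap.mul k (D.Twisted j)).compl₁₂ (quotientLinearMap D j) (quotientLinearMap D j) from
    LinearMap.congr_fun (LinearMap.congr_fun h a) b
  refine SmashCoproduct.basis.ext fun p => SmashCoproduct.basis.ext fun p' => ?_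
  obtain ⟨r, h⟩ := p
  obtain ⟨s, g⟩ := p'
  simp only [SmashCoproduct.basis_apply, LinearMap.compr₂_apply, LinearMap.mul_apply',
    LinearMap.compl₁₂_apply, SmashCoproduct.e_mul_e, quotientLinearMap_e, smul_mul_smul_comm,
    e_mul_e]
  by_cases hg : h = g
  · subst hg
    simp only [if_true, quotientLinearMap_e, smul_smul, QuotientGroup.mk_mul]
    congr 1
    have hrN := D.mem_mk j r
    have hsN := D.mem_mk j s
    have hmulN := D.mem_mul j (QuotientGroup.mk r) (QuotientGroup.mk s)
    have hsN_conj := D.normal.conj_mem _ hsN (j.toFun (QuotientGroup.mk r))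
    rw [← D.P_conj hsN (j.toFun (QuotientGroup.mk r)), D.P_mul hrN hsN_conj,
      D.P_mul (D.N.mul_mem hrN hsN_conj) hmulN]
    congr 1
    group
  · simp [hg]

open Coalgebra

theorem counit_quotientLinearMap (a : SmashCoproduct k Γ H) :
    counit (R := k) (quotientLinearMap D j a) = counit (R := k) a := by
  suffices h : counit ∘ₗ quotientLinearMap D j = counit from LinearMap.congr_fun h a
  refine SmashCoproduct.basis.ext fun p => ?_
  obtain ⟨r, h⟩ := p
  simp only [SmashCoproduct.basis_apply, LinearMap.comp_apply, quotientLinearMap_e, map_smul,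
    counit_e, SmashCoproduct.counit_e]
  split_ifs with hh
  · simp [hh, D.P_apply_one (D.mem_mk j r)]
  · simp

theorem map_comul_quotientLinearMap (a : SmashCoproduct k Γ H) :
    TensorProduct.map (quotientLinearMap D j) (quotientLinearMap D j) (comul a) =
      comul (quotientLinearMap D j a) := by
  suffices h : TensorProduct.map (quotientLinearMap D j) (quotientLinearMap D j) ∘ₗ comul =
      comul ∘ₗ quotientLinearMap D j from LinearMap.congr_fun h a
  refine SmashCoproduct.basis.ext fun p => ?_
  obtain ⟨r, h⟩ := p
  simp only [SmashCoproduct.basis_apply, LinearMap.comp_apply, quotientLinearMap_e, map_smul,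
    comul_e, SmashCoproduct.comul_e, map_sum, TensorProduct.map_tmul, Finset.smul_sum]
  refine Finset.sum_congr rfl fun l _ => ?_
  rw [← TensorProduct.smul_tmul', TensorProduct.tmul_smul, smul_smul, smul_smul, act_mk]
  congr 1
  have hrN := D.mem_mk j r
  have hactN := D.mem_act j l (QuotientGroup.mk r)
  rw [act_mk] at hactN
  have hcoc := D.P_coc hrN l⁻¹ (l * h)
  rw [inv_mul_cancel_left, inv_inv] at hcoc
  rw [hcoc, mul_right_comm, D.P_mul (D.smul_mem l _ hrN) hactN, mul_comm]
  congr 2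
  simp only [smul_mul', smul_inv']
  group

/-- The Hopf algebra map `r # f ↦ u(r) # f Φ(r j(u(r))⁻¹)`. -/
noncomputable def quotientMap : SmashCoproduct k Γ H →ₐc[k] D.Twisted j :=
  BialgHom.ofAlgHom
    (AlgHom.ofLinearMap (quotientLinearMap D j) (quotientLinearMap_one D j)
      (quotientLinearMap_mul D j))
    (AlgHom.ext (counit_quotientLinearMap D j)) (AlgHom.ext (map_comul_quotientLinearMap D j))

theorem quotientMap_e (r : Γ) (h : H) : quotientMap D j (SmashCoproduct.e r h) =
    D.P (r * (j.toFun (QuotientGroup.mk r))⁻¹) h • e (QuotientGroup.mk r) h :=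
  quotientLinearMap_e D j r h

theorem quotientMap_elt (r : Γ) (f : H → k) : quotientMap D j (SmashCoproduct.elt r f) =
    elt (QuotientGroup.mk r)
      (f * (D.Φ ⟨r * (j.toFun (QuotientGroup.mk r))⁻¹, D.mem_mk j r⟩ : H → k)) := by
  rw [SmashCoproduct.elt_eq_sum, map_sum, elt_eq_sum]
  refine Finset.sum_congr rfl fun h _ => ?_
  rw [map_smul, quotientMap_e, smul_smul, Pi.mul_apply, P_eq]

theorem quotientMap_surjective : Function.Surjective (quotientMap D j) := by
  have : LinearMap.range (quotientLinearMap D j) = ⊤ := by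
    rw [eq_top_iff, ← (basis (D := D) (j := j)).span_eq, Submodule.span_le]
    rintro _ ⟨⟨x, h⟩, rfl⟩
    refine ⟨SmashCoproduct.e (j.toFun x) h, ?_⟩
    rw [quotientLinearMap_e, j.mk_toFun, mul_inv_cancel, P_one, one_smul, basis_apply]
  exact LinearMap.range_eq_top.1 this

theorem mem_compatibleData_quotientMap :
    D ∈ compatibleData (quotientMap D j : SmashCoproduct k Γ H →ₐ[k] D.Twisted j) := by
  intro r
  have hr : (QuotientGroup.mk (r : Γ) : Γ ⧸ D.N) = 1 := (QuotientGroup.eq_one_iff _).2 r.2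
  have hΦ : D.Φ ⟨1, D.N.one_mem⟩ = 1 := map_one D.Φ
  change quotientMap D j _ = quotientMap D j _
  simp only [quotientMap_elt, hr, hΦ, QuotientGroup.mk_one, toFun_one, inv_one, mul_one, one_mul,
    Units.val_one]

variable {R : Type x} [Ring R] [Algebra k R]

/-- The linear map `x # δ_h ↦ ρ(j(x) # δ_h)`. -/
noncomputable def descendLinearMap (ρ : SmashCoproduct k Γ H →ₐ[k] R) : D.Twisted j →ₗ[k] R :=
  basis.constr k fun p => ρ (.e (j.toFun p.1) p.2)

variable (ρ : SmashCoproduct k Γ H →ₐ[k] R)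

theorem descendLinearMap_e (x : Γ ⧸ D.N) (h : H) :
    descendLinearMap D j ρ (e x h) = ρ (.e (j.toFun x) h) := by
  rw [← basis_apply]
  exact basis.constr_basis k _ (x, h)

variable {ρ D}

theorem descendLinearMap_mul (hD : D ∈ compatibleData ρ) (a b : D.Twisted j) :
    descendLinearMap D j ρ (a * b) = descendLinearMap D j ρ a * descendLinearMap D j ρ b := by
  suffices h : (LinearMap.mul k (D.Twisted j)).compr₂ (descendLinearMap D j ρ) =
      (LinearMap.mul k R).compl₁₂ (descendLinearMap D j ρ) (descendLinearMap D j ρ) from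
    LinearMap.congr_fun (LinearMap.congr_fun h a) b
  refine basis.ext fun p => basis.ext fun p' => ?_
  obtain ⟨x, h⟩ := p
  obtain ⟨y, g⟩ := p'
  simp only [basis_apply, LinearMap.compr₂_apply, LinearMap.mul_apply', LinearMap.compl₁₂_apply,
    e_mul_e, descendLinearMap_e, ← map_mul, SmashCoproduct.e_mul_e]
  by_cases hg : h = g
  · subst hg
    simp only [if_true, map_smul, descendLinearMap_e]
    rw [← map_e_mul_of_mem_compatibleData hD (D.mem_mul j x y), inv_mul_cancel_right]
  · simp [hg]

/-- The algebra map `x # f ↦ ρ(j(x) # f)`. -/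
noncomputable def descend (hD : D ∈ compatibleData ρ) : D.Twisted j →ₐ[k] R :=
  AlgHom.ofLinearMap (descendLinearMap D j ρ)
    (by
      rw [one_eq, map_sum, ← map_one ρ, SmashCoproduct.one_eq, map_sum]
      exact Finset.sum_congr rfl fun h _ => by rw [descendLinearMap_e, toFun_one])
    (descendLinearMap_mul j hD)

theorem descend_elt (hD : D ∈ compatibleData ρ) (x : Γ ⧸ D.N) (f : H → k) :
    descend j hD (elt x f) = ρ (.elt (j.toFun x) f) := by
  rw [elt_eq_sum, SmashCoproduct.elt_eq_sum, map_sum, map_sum]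
  refine Finset.sum_congr rfl fun h _ => ?_
  rw [map_smul, map_smul]
  exact congrArg _ (descendLinearMap_e D j ρ x h)

theorem descend_quotientMap (hD : D ∈ compatibleData ρ) (a : SmashCoproduct k Γ H) :
    descend j hD (quotientMap D j a) = ρ a := by
  suffices h : descendLinearMap D j ρ ∘ₗ quotientLinearMap D j = ρ.toLinearMap from
    LinearMap.congr_fun h a
  refine SmashCoproduct.basis.ext fun p => ?_
  obtain ⟨r, h⟩ := p
  simp only [SmashCoproduct.basis_apply, LinearMap.comp_apply, quotientLinearMap_e, map_smul,
    descendLinearMap_e, AlgHom.toLinearMap_apply]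
  rw [← map_e_mul_of_mem_compatibleData hD (D.mem_mk j r), inv_mul_cancel_right]

theorem isHopfFactorization_quotientMap (hD : D ∈ compatibleData ρ) :
    IsHopfFactorization ρ (quotientMap D j) (descend j hD) :=
  ⟨quotientMap_surjective D j, descend_quotientMap j hD⟩

end QuotientDatum.Twisted

namespace SmashCoproduct

variable {k : Type u} {Γ : Type v} {H : Type w} {R : Type x} [Field k] [Group Γ] [Ring R]
  [Algebra k R]

section FunctionSubgroup

variable (ρ : SmashCoproduct k Γ H →ₐ[k] R)

/-- The action `r ↦ ρ(r # 1)` of `Γ` by units of `R`. -/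
noncomputable def unitOfGroup : Γ →* Rˣ :=
  ((ρ : SmashCoproduct k Γ H →* R).comp ofGroup).toHomUnits

/-- The action `f ↦ ρ(1 # f)` of the units of `k^H` by units of `R`. -/
noncomputable def unitOfFun : (H → k)ˣ →* Rˣ :=
  Units.map (ρ.comp ofFun : (H → k) →* R)

/-- The subgroup `N₀` of the elements of `Γ` which `ρ` identifies with functions, defined through
units of `k^H`: for `ρ` injective on `k^H` the function is automatically a unit, see
`mem_functionSubgroup_iff`. -/
noncomputable def functionSubgroup : Subgroup Γ :=
  (unitOfFun ρ).range.comap (unitOfGroup ρ)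

variable {ρ}

theorem unitOfGroup_eq_unitOfFun_iff {r : Γ} {f : (H → k)ˣ} :
    unitOfGroup ρ r = unitOfFun ρ f ↔ ρ (elt r 1) = ρ (elt 1 (f : H → k)) :=
  Units.ext_iff

theorem mem_functionSubgroup_of_unit {r : Γ} {f : (H → k)ˣ}
    (h : ρ (elt r 1) = ρ (elt 1 (f : H → k))) : r ∈ functionSubgroup ρ :=
  ⟨f, (unitOfGroup_eq_unitOfFun_iff.2 h).symm⟩

theorem map_elt_conj {r : Γ} {f : H → k} (h : ρ (elt r 1) = ρ (elt 1 f)) (s : Γ) :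
    ρ (elt (s * r * s⁻¹) 1) = ρ (elt 1 f) := calc
  ρ (elt (s * r * s⁻¹) 1) = ρ (elt s 1) * ρ (elt r 1) * ρ (elt s⁻¹ 1) := by
    simp only [← map_mul, elt_mul_elt, mul_one]
  _ = ρ (elt 1 f) := by
    simp only [h, ← map_mul, elt_mul_elt, mul_one, one_mul, mul_inv_cancel]

theorem functionSubgroup_normal : (functionSubgroup ρ).Normal where
  conj_mem := by
    rintro r ⟨f, hf⟩ s
    exact mem_functionSubgroup_of_unit (map_elt_conj (unitOfGroup_eq_unitOfFun_iff.1 hf.symm) s)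

section Injective

variable (hρ : Function.Injective fun f : H → k => ρ (elt 1 f))

include hρ

theorem map_elt_ne_zero (r : Γ) {f : H → k} (hf : f ≠ 0) : ρ (elt r f) ≠ 0 := by
  rw [elt_eq_ofGroup_mul_ofFun, map_mul]
  refine fun h => hf (hρ (((unitOfGroup ρ r).mul_right_eq_zero.1 h).trans ?_))
  exact (map_zero (ρ.comp ofFun)).symm

theorem isUnit_of_map_elt_eq {r : Γ} {f : H → k} (h : ρ (elt r 1) = ρ (elt 1 f)) : IsUnit f := by
  classical
  rw [Pi.isUnit_iff]
  refine fun g => isUnit_iff_ne_zero.2 fun hg => ?_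
  have hfg : Pi.single g 1 * f = 0 :=
    (Pi.single_mul_left (i := g) (f := f) 1).symm.trans (by rw [hg, mul_zero, Pi.single_zero])
  have hzero : ρ (elt 1 (Pi.single g 1)) * unitOfGroup ρ r = 0 := calc
    _ = ρ (elt 1 (Pi.single g 1)) * ρ (elt 1 f) := congrArg _ h
    _ = ρ (ofFun (Pi.single g 1 * f)) := by rw [← map_mul, elt_mul_elt, one_mul]; rfl
    _ = 0 := by rw [hfg, map_zero, map_zero]
  exact map_elt_ne_zero hρ 1 (Pi.single_ne_zero_iff.2 one_ne_zero)
    ((Units.mul_left_eq_zero _).1 hzero)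

theorem mem_functionSubgroup_iff {r : Γ} :
    r ∈ functionSubgroup ρ ↔ ∃ f : H → k, ρ (elt r 1) = ρ (elt 1 f) := by
  refine ⟨fun ⟨f, hf⟩ => ⟨f, unitOfGroup_eq_unitOfFun_iff.1 hf.symm⟩, fun ⟨f, hf⟩ => ?_⟩
  exact mem_functionSubgroup_of_unit (f := (isUnit_of_map_elt_eq hρ hf).unit) hf

theorem unitOfFun_injective : Function.Injective (unitOfFun ρ) :=
  fun _ _ h => Units.ext (hρ (Units.ext_iff.1 h))

/-- The group morphism `Φ : N₀ → (k^H)ˣ` with `ρ(r # 1) = ρ(1 # Φ(r))`. -/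
noncomputable def functionHom : functionSubgroup ρ →* (H → k)ˣ :=
  (MonoidHom.ofInjective (unitOfFun_injective hρ)).symm.toMonoidHom.comp
    ((unitOfGroup ρ).subgroupComap _)

theorem map_elt_eq_functionHom (r : functionSubgroup ρ) :
    ρ (elt (r : Γ) 1) = ρ (elt 1 (functionHom hρ r : H → k)) :=
  unitOfGroup_eq_unitOfFun_iff.1
    (MonoidHom.apply_ofInjective_symm (unitOfFun_injective hρ) ⟨unitOfGroup ρ r, r.2⟩).symm

theorem functionHom_eq {r : Γ} {hr : r ∈ functionSubgroup ρ} {f : (H → k)ˣ}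
    (h : ρ (elt r 1) = ρ (elt 1 (f : H → k))) : functionHom hρ ⟨r, hr⟩ = f :=
  Units.ext (hρ ((map_elt_eq_functionHom hρ ⟨r, hr⟩).symm.trans h))

end Injective

end FunctionSubgroup

variable [Group H] [MulDistribMulAction H Γ] {ρ : SmashCoproduct k Γ H →ₐ[k] R}

/-- The family `c : H → (k^H)ˣ` plays the role of `g ↦ Φ(g.r)` for an element `r` of the subgroup
`N`, so that `N` consists of the `r` admitting such a family. -/
structure IsCocycleLift (ρ : SmashCoproduct k Γ H →ₐ[k] R) (r : Γ) (c : H → (H → k)ˣ) : Prop where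
  map_smul : ∀ g : H, unitOfGroup ρ (g • r) = unitOfFun ρ (c g)
  cocycle : ∀ g h l : H, (c g : H → k) (l * h) = (c (l⁻¹ * g) : H → k) h * (c g : H → k) l

namespace IsCocycleLift

variable {r s : Γ} {c d : H → (H → k)ˣ}

theorem one : IsCocycleLift ρ 1 1 where
  map_smul g := by rw [smul_one, map_one, Pi.one_apply, map_one]
  cocycle _ _ _ := (one_mul 1).symm

theorem mul (hr : IsCocycleLift ρ r c) (hs : IsCocycleLift ρ s d) :
    IsCocycleLift ρ (r * s) (c * d) where
  map_smul g := by rw [smul_mul', map_mul, hr.map_smul, hs.map_smul, Pi.mul_apply, map_mul]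
  cocycle g h l := by
    simp only [Pi.mul_apply, Units.val_mul, hr.cocycle g h l, hs.cocycle g h l]
    ring

theorem inv (hr : IsCocycleLift ρ r c) : IsCocycleLift ρ r⁻¹ c⁻¹ where
  map_smul g := by rw [smul_inv', map_inv, hr.map_smul, Pi.inv_apply, map_inv]
  cocycle g h l := by
    simp only [Pi.inv_apply, Units.val_inv_eq_inv_val, hr.cocycle g h l, mul_inv]

theorem conj (hr : IsCocycleLift ρ r c) (s : Γ) : IsCocycleLift ρ (s * r * s⁻¹) c where
  map_smul g := by
    rw [smul_mul', smul_mul', smul_inv', unitOfGroup_eq_unitOfFun_iff]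
    exact map_elt_conj (unitOfGroup_eq_unitOfFun_iff.1 (hr.map_smul g)) _
  cocycle := hr.cocycle

theorem smul (hr : IsCocycleLift ρ r c) (a : H) : IsCocycleLift ρ (a • r) fun g => c (g * a) where
  map_smul g := by rw [← mul_smul, hr.map_smul]
  cocycle g h l := by rw [hr.cocycle, mul_assoc]

theorem map_elt_smul (hr : IsCocycleLift ρ r c) (g : H) :
    ρ (elt (g • r) 1) = ρ (elt 1 (c g : H → k)) :=
  unitOfGroup_eq_unitOfFun_iff.1 (hr.map_smul g)

theorem map_elt (hr : IsCocycleLift ρ r c) : ρ (elt r 1) = ρ (elt 1 (c 1 : H → k)) := by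
  simpa only [one_smul] using hr.map_elt_smul 1

theorem mem_functionSubgroup (hr : IsCocycleLift ρ r c) : r ∈ functionSubgroup ρ :=
  mem_functionSubgroup_of_unit hr.map_elt

end IsCocycleLift

variable (ρ) in
/-- The subgroup `N`, described by the families `g ↦ Φ(g.r)` in order not to choose `Φ`; see
`mem_cocycleSubgroup_iff` for the condition on `Φ`. -/
noncomputable def cocycleSubgroup : Subgroup Γ where
  carrier := {r | ∃ c, IsCocycleLift ρ r c}
  one_mem' := ⟨_, .one⟩
  mul_mem' := fun ⟨_, hr⟩ ⟨_, hs⟩ => ⟨_, hr.mul hs⟩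
  inv_mem' := fun ⟨_, hr⟩ => ⟨_, hr.inv⟩

theorem cocycleSubgroup_le_functionSubgroup : cocycleSubgroup ρ ≤ functionSubgroup ρ :=
  fun _ ⟨_, hr⟩ => hr.mem_functionSubgroup

variable (hρ : Function.Injective fun f : H → k => ρ (elt 1 f))

theorem isCocycleLift_functionHom {r : Γ} (hr : ∀ g : H, g • r ∈ functionSubgroup ρ)
    (hΦ : ∀ g h l : H, (functionHom hρ ⟨g • r, hr g⟩ : H → k) (l * h) =
      (functionHom hρ ⟨(l⁻¹ * g) • r, hr (l⁻¹ * g)⟩ : H → k) h *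
        (functionHom hρ ⟨g • r, hr g⟩ : H → k) l) :
    IsCocycleLift ρ r fun g => functionHom hρ ⟨g • r, hr g⟩ where
  map_smul g := unitOfGroup_eq_unitOfFun_iff.2 (map_elt_eq_functionHom hρ ⟨g • r, hr g⟩)
  cocycle := hΦ

theorem mem_cocycleSubgroup_iff {r : Γ} :
    r ∈ cocycleSubgroup ρ ↔ r ∈ functionSubgroup ρ ∧
      ∃ hr : ∀ h : H, h • r ∈ functionSubgroup ρ, ∀ h g l : H,
        (functionHom hρ ⟨g • r, hr g⟩ : H → k) (l * h) =
          (functionHom hρ ⟨(l⁻¹ * g) • r, hr (l⁻¹ * g)⟩ : H → k) h *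
            (functionHom hρ ⟨g • r, hr g⟩ : H → k) l := by
  constructor
  · rintro ⟨c, hc⟩
    refine ⟨hc.mem_functionSubgroup, fun h => (hc.smul h).mem_functionSubgroup, fun h g l => ?_⟩
    simp only [functionHom_eq hρ (hc.map_elt_smul _), hc.cocycle g h l]
  · rintro ⟨-, hr, hΦ⟩
    exact ⟨_, isCocycleLift_functionHom hρ hr fun g h l => hΦ h g l⟩

/-- The quotient datum `(N, Φ_{|N})`. -/
noncomputable def maximalDatum : QuotientDatum k Γ H where
  N := cocycleSubgroup ρ
  normal := ⟨fun _ ⟨_, hr⟩ s => ⟨_, hr.conj s⟩⟩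
  smul_mem := fun h _ ⟨_, hr⟩ => ⟨_, hr.smul h⟩
  Φ := (functionHom hρ).comp (Subgroup.inclusion cocycleSubgroup_le_functionSubgroup)
  Φ_mul := by
    rintro ⟨r, c, hc⟩ l h
    have hr : functionHom hρ ⟨r, hc.mem_functionSubgroup⟩ = c 1 := functionHom_eq hρ hc.map_elt
    have hlr : functionHom hρ ⟨l⁻¹ • r, (hc.smul l⁻¹).mem_functionSubgroup⟩ = c l⁻¹ :=
      functionHom_eq hρ (hc.map_elt_smul l⁻¹)
    change (functionHom hρ ⟨r, _⟩ : H → k) (l * h) =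
      (functionHom hρ ⟨l⁻¹ • r, _⟩ : H → k) h * (functionHom hρ ⟨r, _⟩ : H → k) l
    rw [hr, hlr, hc.cocycle, mul_one]
  Φ_conj := fun ⟨_, _, hc⟩ s =>
    (functionHom_eq hρ hc.map_elt).trans (functionHom_eq hρ (hc.conj s).map_elt).symm

theorem maximalDatum_mem_compatibleData : maximalDatum hρ ∈ compatibleData ρ :=
  fun r => map_elt_eq_functionHom hρ (Subgroup.inclusion cocycleSubgroup_le_functionSubgroup r)

theorem isCocycleLift_of_mem_compatibleData {D : QuotientDatum k Γ H} (hD : D ∈ compatibleData ρ)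
    (r : D.N) : IsCocycleLift ρ (r : Γ) fun g => D.Φ ⟨g • (r : Γ), D.smul_mem g r r.2⟩ where
  map_smul g := unitOfGroup_eq_unitOfFun_iff.2 (hD ⟨g • (r : Γ), D.smul_mem g r r.2⟩)
  cocycle g h l := by
    simpa only [mul_smul] using D.Φ_mul ⟨g • (r : Γ), D.smul_mem g r r.2⟩ l h

theorem isGreatest_maximalDatum : IsGreatest (compatibleData ρ) (maximalDatum hρ) :=
  ⟨maximalDatum_mem_compatibleData hρ, fun _ hD =>
    ⟨fun r hr => ⟨_, isCocycleLift_of_mem_compatibleData hD ⟨r, hr⟩⟩,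
      MonoidHom.ext fun r => functionHom_eq hρ (hD r)⟩⟩

end SmashCoproduct

namespace SmashCoproduct

variable {k : Type u} {Γ : Type v} {H : Type w} [Field k] [Group Γ] [Group H] [Fintype H]
  [DecidableEq H] [MulDistribMulAction H Γ] {M : Type x} [Ring M] [Bialgebra k M]
  (q : SmashCoproduct k Γ H →ₐc[k] M)

/-- The linear map `a ↦ (q(1 # δ_m) ⊗ 1) Δ(a)` on a quotient `q` of `k[Γ] ⋊ k^H`, which extracts
from `Δ(a)` the terms whose left factor lies over `δ_m`. -/
noncomputable def leftComponent (m : H) : M →ₗ[k] M ⊗[k] M :=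
  LinearMap.mulLeft k (q (e 1 m) ⊗ₜ[k] 1) ∘ₗ Coalgebra.comul

theorem leftComponent_map_elt (m : H) (r : Γ) (f : H → k) : leftComponent q m (q (elt r f)) =
    q (e r m) ⊗ₜ[k] q (elt (m⁻¹ • r) fun h => f (m * h)) := by
  have h := congrArg (Algebra.TensorProduct.map (q : _ →ₐ[k] M) (q : _ →ₐ[k] M))
    (e_one_tmul_one_mul_comul_elt m r f)
  rw [map_mul, Algebra.TensorProduct.map_tmul, Algebra.TensorProduct.map_tmul, map_one] at h
  rw [leftComponent, LinearMap.comp_apply, ← CoalgHomClass.map_comp_comul_apply]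
  exact h

theorem leftComponent_one_map_elt (r : Γ) (f : H → k) :
    leftComponent q 1 (q (elt r f)) = q (e r 1) ⊗ₜ[k] q (elt r f) := by
  simpa only [inv_one, one_smul, one_mul] using leftComponent_map_elt q 1 r f

variable {q}
  (hq : Function.Injective fun f : H → k => (q : SmashCoproduct k Γ H →ₐ[k] M) (elt 1 f))

include hq

theorem map_e_ne_zero (r : Γ) (h : H) : q (e r h) ≠ 0 :=
  map_elt_ne_zero hq r
    (Pi.single_ne_zero_iff.2 one_ne_zero)

theorem smul_map_elt_inv_smul {r : Γ} {f : H → k} (h : q (elt r 1) = q (elt 1 f)) (l : H) :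
    f l • q (elt (l⁻¹ • r) 1) = q (elt 1 fun h => f (l * h)) := by
  have he : q (e r l) = f l • q (e 1 l) := calc
    q (e r l) = q (elt r 1) * q (e 1 l) := by
      rw [← map_mul, elt_mul_e, mul_one, Pi.one_apply, one_smul]
    _ = f l • q (e 1 l) := by rw [h, ← map_mul, elt_mul_e, mul_one, map_smul]
  refine tmul_right_injective_of_ne_zero (K := k) (map_e_ne_zero hq 1 l) ?_
  calc q (e 1 l) ⊗ₜ[k] (f l • q (elt (l⁻¹ • r) 1))
      = leftComponent q l (q (elt r 1)) := by
        rw [leftComponent_map_elt, he, TensorProduct.smul_tmul]; rfl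
    _ = q (e 1 l) ⊗ₜ[k] q (elt 1 fun h => f (l * h)) := by
        rw [h, leftComponent_map_elt, smul_one]

theorem smul_mem_functionSubgroup (l : H) {r : Γ}
    (hr : r ∈ functionSubgroup (q : SmashCoproduct k Γ H →ₐ[k] M)) :
    l • r ∈ functionSubgroup (q : SmashCoproduct k Γ H →ₐ[k] M) := by
  obtain ⟨f, hf⟩ := hr
  have h := smul_map_elt_inv_smul hq (unitOfGroup_eq_unitOfFun_iff.1 hf.symm) l⁻¹
  rw [inv_inv] at h
  have hfl : (f : H → k) l⁻¹ ≠ 0 := (Pi.isUnit_iff.1 f.isUnit l⁻¹).ne_zero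
  refine (mem_functionSubgroup_iff hq).2
    ⟨((f : H → k) l⁻¹)⁻¹ • fun h => (f : H → k) (l⁻¹ * h), ?_⟩
  rw [elt_smul, map_smul]
  exact (eq_inv_smul_iff₀ hfl).2 h

theorem functionSubgroup_le_cocycleSubgroup :
    functionSubgroup (q : SmashCoproduct k Γ H →ₐ[k] M) ≤
      cocycleSubgroup (q : SmashCoproduct k Γ H →ₐ[k] M) := by
  intro r hr
  have hr' (g : H) := smul_mem_functionSubgroup hq g hr
  refine (mem_cocycleSubgroup_iff hq).2 ⟨hr, hr', fun h g l => ?_⟩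
  have hΦ (g : H) : q (elt (g • r) 1) = _ :=
    map_elt_eq_functionHom hq ⟨g • r, hr' g⟩
  have hl := smul_map_elt_inv_smul hq (hΦ g) l
  rw [← mul_smul, hΦ (l⁻¹ * g), ← map_smul, ← elt_smul] at hl
  exact (congrFun (hq hl) h).symm.trans (mul_comm _ _)

theorem mul_inv_mem_functionSubgroup {r s : Γ} (h : q (e r 1) = q (e s 1)) :
    r * s⁻¹ ∈ functionSubgroup (q : SmashCoproduct k Γ H →ₐ[k] M) := by
  have hrs : q (e (r * s⁻¹) 1) = q (e 1 1) := calc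
    q (e (r * s⁻¹) 1) = q (e r 1) * q (elt s⁻¹ 1) := by rw [← map_mul, e, e, elt_mul_elt, mul_one]
    _ = q (e 1 1) := by rw [h, ← map_mul, e, e, elt_mul_elt, mul_one, mul_inv_cancel]
  have hprop (m : H) : ∃ c : k, q (e (r * s⁻¹) m) = c • q (e 1 m) := by
    have hm := congrArg (leftComponent q m) hrs
    rw [e, e, leftComponent_map_elt, leftComponent_map_elt] at hm
    refine exists_eq_smul_of_tmul_eq_tmul (map_elt_ne_zero hq _ ?_) hm
    exact fun h0 => one_ne_zero (α := k) (by simpa using congrFun h0 m⁻¹)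
  choose c hc using hprop
  refine (mem_functionSubgroup_iff hq).2 ⟨c, ?_⟩
  change q _ = q _
  simp only [elt_eq_sum, map_sum, map_smul, Pi.one_apply, one_smul, hc]

variable (j : NormalizedSection (maximalDatum hq).N)

theorem linearIndependent_map_e :
    LinearIndependent k fun x : Γ ⧸ (maximalDatum hq).N => q (e (j.toFun x) 1) := by
  refine linearIndependent_of_map_eq_tmul_self (fun x y hxy => ?_)
    (fun x => map_e_ne_zero hq _ 1) (leftComponent q 1) fun x => leftComponent_one_map_elt q _ _
  have hN : j.toFun x * (j.toFun y)⁻¹ ∈ (maximalDatum hq).N :=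
    functionSubgroup_le_cocycleSubgroup hq (mul_inv_mem_functionSubgroup hq hxy)
  rw [← j.mk_toFun x, ← j.mk_toFun y, ← mul_inv_eq_one, ← QuotientGroup.mk_inv,
    ← QuotientGroup.mk_mul]
  exact (QuotientGroup.eq_one_iff _).2 hN

open QuotientDatum.Twisted in
theorem descend_maximalDatum_injective :
    Function.Injective (descend j (maximalDatum_mem_compatibleData hq)) := by
  refine (injective_iff_map_eq_zero _).2 fun z hz => ?_
  obtain ⟨F, rfl⟩ := exists_finsupp_sum_elt_eq z
  have hF : ∑ x ∈ F.support, q (elt (j.toFun x) (F x)) = 0 := by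
    refine Eq.trans ?_ hz
    simp only [Finsupp.sum, map_sum, descend_elt]
    rfl
  have hF₁ : ∑ x ∈ F.support, q (e (j.toFun x) 1) ⊗ₜ[k] q (elt (j.toFun x) (F x)) = 0 := by
    simpa only [map_sum, leftComponent_one_map_elt, map_zero] using congrArg (leftComponent q 1) hF
  have hF₀ := eq_zero_of_sum_tmul_eq_zero ((linearIndependent_map_e hq j).linearIndepOn _) hF₁
  have hsupp : F.support = ∅ := Finset.eq_empty_of_forall_notMem fun x hx =>
    map_elt_ne_zero hq (j.toFun x) (Finsupp.mem_support_iff.1 hx) (hF₀ x hx)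
  rw [Finsupp.sum, hsupp, Finset.sum_empty]

end SmashCoproduct

theorem NormalizedSection.nonempty {Γ : Type v} [Group Γ] (N : Subgroup Γ) :
    Nonempty (NormalizedSection N) := by
  classical
  refine ⟨⟨Function.update Quotient.out (QuotientGroup.mk 1) 1, fun x => ?_,
    Function.update_self ..⟩⟩
  rcases eq_or_ne x (QuotientGroup.mk 1) with rfl | hx
  · rw [Function.update_self]
  · rw [Function.update_of_ne hx]
    exact Quotient.out_eq x

namespace QuotientDatum.Twisted

variable {k : Type u} {Γ : Type v} {H : Type w} {R : Type x} [Field k] [Group Γ] [Group H]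
  [Fintype H] [DecidableEq H] [MulDistribMulAction H Γ] [Ring R] [Algebra k R]
  {ρ : SmashCoproduct k Γ H →ₐ[k] R} {D : QuotientDatum k Γ H}

theorem quotientMap_eq_zero_of_isHopfFactorization
    (hρ : Function.Injective fun f : H → k => ρ (.elt 1 f)) (hD : IsGreatest (compatibleData ρ) D)
    (j : NormalizedSection D.N) {M : Type y} [Ring M] [HopfAlgebra k M]
    {q : SmashCoproduct k Γ H →ₐc[k] M} {ψ : M →ₐ[k] R} (h : IsHopfFactorization ρ q ψ)
    (a : SmashCoproduct k Γ H) (ha : q a = 0) : quotientMap D j a = 0 := by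
  have hq : Function.Injective fun f : H → k => (q : SmashCoproduct k Γ H →ₐ[k] M) (.elt 1 f) :=
    fun _ _ hfg => hρ ((h.factors _).symm.trans ((congrArg ψ hfg).trans (h.factors _)))
  let D' := SmashCoproduct.maximalDatum hq
  obtain ⟨j'⟩ := NormalizedSection.nonempty D'.N
  have hqD' : D' ∈ compatibleData (q : SmashCoproduct k Γ H →ₐ[k] M) :=
    SmashCoproduct.maximalDatum_mem_compatibleData hq
  have ha' : quotientMap D' j' a = 0 :=
    SmashCoproduct.descend_maximalDatum_injective hq j'
      ((descend_quotientMap j' hqD' a).trans (ha.trans (map_zero _).symm))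
  have hρD' : D' ∈ compatibleData ρ := fun r => by
    rw [← h.factors, ← h.factors]
    exact congrArg ψ (hqD' r)
  have hD' : D' ∈ compatibleData (quotientMap D j : SmashCoproduct k Γ H →ₐ[k] D.Twisted j) :=
    mem_compatibleData_of_le (hD.2 hρD') (mem_compatibleData_quotientMap D j)
  exact (descend_quotientMap j' hD' a).symm.trans ((congrArg _ ha').trans (map_zero _))

theorem isHopfImage_quotientMap (hρ : Function.Injective fun f : H → k => ρ (.elt 1 f))
    (hD : IsGreatest (compatibleData ρ) D) (j : NormalizedSection D.N) :
    IsHopfImage.{u, _, x, _, y} ρ (quotientMap D j) (descend j hD.1) where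
  isHopfFactorization := isHopfFactorization_quotientMap j hD.1
  existsUnique M _ _ q ψ h := by
    obtain ⟨f, hf⟩ := exists_bialgHom_comp_eq q h.surjective (quotientMap D j)
      (quotientMap_eq_zero_of_isHopfFactorization hρ hD j h)
    refine ⟨f, ⟨hf, fun m => ?_⟩, fun g hg => BialgHom.ext fun m => ?_⟩ <;>
      obtain ⟨a, rfl⟩ := h.surjective m
    · rw [hf, descend_quotientMap, h.factors]
    · rw [hg.1, hf]

end QuotientDatum.Twisted

open SmashCoproduct QuotientDatum.Twisted

theorem corollary4p4 {k : Type u} {Γ : Type v} {H : Type w} {R : Type x} [Field k] [Group Γ]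
    [Group H] [Fintype H] [DecidableEq H] [MulDistribMulAction H Γ] [Ring R] [Algebra k R]
    (ρ : SmashCoproduct k Γ H →ₐ[k] R)
    (hρ : Function.Injective fun f : H → k => ρ (SmashCoproduct.elt 1 f)) :
    ∃ N₀ : Subgroup Γ, N₀.Normal ∧
      (∀ r : Γ, r ∈ N₀ ↔
        ∃ f : H → k, ρ (SmashCoproduct.elt r 1) = ρ (SmashCoproduct.elt 1 f)) ∧
      ∃ Φ : N₀ →* (H → k)ˣ,
        (∀ r : N₀, ρ (SmashCoproduct.elt (r : Γ) 1) = ρ (SmashCoproduct.elt 1 (Φ r : H → k))) ∧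
        (∀ Φ' : N₀ →* (H → k)ˣ, (∀ r : N₀,
          ρ (SmashCoproduct.elt (r : Γ) 1) = ρ (SmashCoproduct.elt 1 (Φ' r : H → k))) → Φ' = Φ) ∧
        ∃ D : QuotientDatum k Γ H,
          (∀ r : Γ, r ∈ D.N ↔ r ∈ N₀ ∧ ∃ hr : ∀ h : H, h • r ∈ N₀, ∀ h g l : H,
            (Φ ⟨g • r, hr g⟩ : H → k) (l * h) =
              (Φ ⟨(l⁻¹ * g) • r, hr (l⁻¹ * g)⟩ : H → k) h * (Φ ⟨g • r, hr g⟩ : H → k) l) ∧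
          (∀ (r : Γ) (hr : r ∈ D.N) (hr₀ : r ∈ N₀), D.Φ ⟨r, hr⟩ = Φ ⟨r, hr₀⟩) ∧
          D ∈ compatibleData ρ ∧
          ∀ j : NormalizedSection D.N,
            ∃ (q : SmashCoproduct k Γ H →ₐc[k] D.Twisted j) (ρ' : D.Twisted j →ₐ[k] R),
              (∀ (r : Γ) (f : H → k), q (SmashCoproduct.elt r f) =
                QuotientDatum.Twisted.elt (QuotientGroup.mk r)
                  (f * (D.Φ ⟨r * (j.toFun (QuotientGroup.mk r))⁻¹, D.mem_mk j r⟩ : H → k))) ∧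
              (∀ (x : Γ ⧸ D.N) (f : H → k), ρ' (QuotientDatum.Twisted.elt x f) =
                ρ (SmashCoproduct.elt (j.toFun x) f)) ∧
              IsHopfImage.{u, _, x, _, y} ρ q ρ' := by
  refine ⟨functionSubgroup ρ, functionSubgroup_normal, fun _ => mem_functionSubgroup_iff hρ,
    functionHom hρ, map_elt_eq_functionHom hρ,
    fun _ hΦ' => MonoidHom.ext fun r => (functionHom_eq hρ (hΦ' r)).symm, ?_⟩
  have hD := isGreatest_maximalDatum hρ
  refine ⟨maximalDatum hρ, fun _ => mem_cocycleSubgroup_iff hρ, fun _ _ _ => rfl, hD.1, fun j => ?_⟩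
  exact ⟨quotientMap _ j, descend j hD.1, quotientMap_elt _ j, descend_elt j hD.1,
    isHopfImage_quotientMap hρ hD j⟩
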